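/- Let $E$ be an elliptic curve over a field $k$ with a fixed trivialization of $\omega_E$. For line bundles $X,Y$ put $\mathrm{Hom}^*(X,Y)=H^*(E,X^{-1}Y)$ (in degrees $0$ and $1$), with the standard composition (cup product) and the Serre pairing $b:\mathrm{Hom}^*(X,Y)\otimes\mathrm{Hom}^*(Y,X)\to H^1(E,\mathcal O)\to k$. Let a notion of transversality for pairs of line bundles be given such that: $(L,M)$ is transversal iff $(M,L)$ is, iff $(L^{-1},M^{-1})$ is, iff $(LN,MN)$ is, for every line bundle $N$; for every finite collection $(L_i)$ and every integer $d$ there are infinitely many isomorphism classes of line bundles $L$ of degree $d$ such that $L$ and $L^2$ are transversal to all $L_i$; and if $(L,M)$ is transversal then $L\not\simeq M$. A collection $(X_0,\dots,X_n)$ is transversal if $(X_i,X_j)$ is transversal for all $i<j$. A transversal $A_\infty$-structure consists of linear maps $m_n:\mathrm{Hom}^*(X_0,X_1)\otimes\cdots\otimes\mathrm{Hom}^*(X_{n-1},X_n)\to\mathrm{Hom}^*(X_0,X_n)$ of degree $2-n$, $n\ge1$, for transversal $(X_0,\dots,X_n)$, such that for homogeneous $a_i$ of degree $\tilde a_i$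 $$\sum_{k+l=n+1}\sum_{j=1}^k(-1)^{l(\tilde a_1+\dots+\tilde a_{j-1})+j(l+1)}m_k(a_1,\dots,a_{j-1},m_l(a_j,\dots,a_{j+l-1}),a_{j+l},\dots,a_n)=0 .$$ It is admissible if $m_1=0$, $m_2$ is the standard composition, tensor multiplication by every line bundle is strictly compatible with $m$, and $b(m_n(a_1,\dots,a_n),a_{n+1})=(-1)^{n(\tilde a_1+1)}b(a_1,m_n(a_2,\dots,a_{n+1}))$. A homotopy between two transversal $A_\infty$-structures is an $A_\infty$-morphism $(f_n)$ defined on transversal collections which is the identity on objects and has $f_1=\mathrm{id}$. If $(\mathcal O,L_1,L_1M,L_1ML_2)$ is transversal, write $m_3:H^0(L_1)\otimes H^1(M)\otimes H^0(L_2)\to H^0(L_1ML_2)$ for the triple product along $\mathcal O\to L_1\to L_1M\to L_1ML_2$. 1. Let $m$ be an admissible transversal $A_\infty$-structure, $n=n'+n''$ with $n',n''>0$, $\deg L_i'=n'$, $\deg L_i''=n''$, $L_i=L_i'L_i''$ ($i=1,2$), $\deg M=-n$, and assume that $(\mathcal O,L_1',L_1,L_1M,L_1ML_2',L_1ML_2)$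 is transversal. Then for all $s_i'\in H^0(L_i')$, $s_i''\in H^0(L_i'')$, $e\in H^1(M)$ $$m_3(s_1's_1'',e,s_2's_2'')=m_3(s_1',s_1''e,s_2')\,s_2''+s_1'\,m_3(s_1'',es_2',s_2'').$$ 2. Let $n>0$, $\deg L_1=\deg L_2=n$, $\deg M=-n$, with $(\mathcal O,L_1,L_1M,L_1ML_2)$ transversal. The triple product $m_3:H^0(L_1)\otimes H^1(M)\otimes H^0(L_2)\to H^0(L_1ML_2)$ of an admissible transversal $A_\infty$-structure $m$ is homotopy invariant: if there is a homotopy from $m$ to a transversal $A_\infty$-structure $m'$, then $m_3'=m_3$ on this space. 3. Hence these homotopy-invariant triple products reduce to the ones with $n=1$: for $L_1,M,L_2$ as in 2 and all $s_1\in H^0(L_1)$, $e\in H^1(M)$, $s_2\in H^0(L_2)$ there are finitely many line bundles $B_j,P_j,Q_j,R_j,C_j$ with $B_jP_jQ_jR_jC_j=L_1ML_2$, $\deg P_j=\deg R_j=1$, $\deg Q_j=-1$, $(\mathcal O,P_j,P_jQ_j,P_jQ_jR_j)$ transversal, and $b_j\in H^0(B_j)$, $p_j\in H^0(P_j)$,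 $q_j\in H^1(Q_j)$, $r_j\in H^0(R_j)$, $c_j\in H^0(C_j)$, such that for every admissible transversal $A_\infty$-structure $m$ $$m_3(s_1,e,s_2)=\sum_j b_j\,m_3(p_j,q_j,r_j)\,c_j .$$ -/

import Mathlib

noncomputable section

namespace LineBundleAInf

universe u w

/-! ## Composable chains -/

/-- A chain `X = X₀ ⟶ X₁ ⟶ ⋯ ⟶ Xₙ = Y` of composable morphisms `(a₁, …, aₙ)`,
written from left to right. -/
inductive Chain {Ob : Type u} (H : Ob → Ob → Type w) : Ob → Ob → Type (max u w)
  | nil (X : Ob) : Chain H X X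
  | cons {X Y Z : Ob} (a : H X Y) (p : Chain H Y Z) : Chain H X Z

namespace Chain

variable {Ob : Type u} {H H' : Ob → Ob → Type w}

/-- The number of morphisms in the chain. -/
def length : {X Y : Ob} → Chain H X Y → ℕ
  | _, _, nil _ => 0
  | _, _, cons _ p => p.length + 1

/-- The objects `X₀, X₁, …, Xₙ` of the chain. -/
def objects : {X Y : Ob} → Chain H X Y → List Ob
  | _, _, nil X => [X]
  | X, _, cons _ p => X :: p.objects

/-- Concatenation of chains. -/
def append : {X Y Z : Ob} → Chain H X Y → Chain H Y Z → Chain H X Z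
  | _, _, _, nil _, q => q
  | _, _, _, cons a p, q => cons a (p.append q)

/-- The chain with one morphism. -/
def single {X Y : Ob} (a : H X Y) : Chain H X Y := cons a (nil Y)

/-- Apply a map to every member of the chain, keeping the objects. -/
def map (f : ∀ {X Y : Ob}, H X Y → H' X Y) : {X Y : Ob} → Chain H X Y → Chain H' X Y
  | _, _, nil X => nil X
  | _, _, cons a p => cons (f a) (p.map f)

/-- All ways of writing a chain as the concatenation of two chains. -/
def splits : {X Y : Ob} → Chain H X Y → List ((Z : Ob) × Chain H X Z × Chain H Z Y)
  | _, _, nil X => [⟨X, nil X, nil X⟩]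
  | X, _, cons a p =>
      ⟨X, nil X, cons a p⟩ :: p.splits.map (fun t => ⟨t.1, cons a t.2.1, t.2.2⟩)

/-- All ways of cutting a chain into consecutive non-empty blocks
(each one is a chain of chains). -/
def blocks : {X Y : Ob} → Chain H X Y → List (Chain (Chain H) X Y)
  | _, _, nil X => [nil X]
  | _, _, cons a p => p.blocks.flatMap fun P =>
      cons (single a) P ::
        (match P with
          | nil _ => []
          | cons q Q => [cons (cons a q) Q])

/-- The lengths of the blocks of a chain of chains. -/
def blockLengths : {X Y : Ob} → Chain (Chain H) X Y → List ℕ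
  | _, _, nil _ => []
  | _, _, cons q Q => q.length :: Q.blockLengths

end Chain

/-! ## Divisors, line bundles and their cohomology on a complete regular curve

The curve is given by its field of rational functions `K` over `k`. Its closed points are the
discrete valuation rings of `K / k`; a line bundle is the invertible subsheaf `𝒪(D)` of the
constant sheaf `K`, for a divisor `D`. -/

/-- A closed point of the complete regular curve with function field `K / k`:
a discrete valuation ring of `K` containing `k` (it is the local ring at that point). -/
structure Place (k K : Type u) [Field k] [Field K] [Algebra k K] where
  /-- the local ring -/
  ring : ValuationSubring K
  const_mem : ∀ c : k, algebraMap k K c ∈ ring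
  isDVR : IsDiscreteValuationRing ring

section Curve

variable {k K : Type u} [Field k] [Field K] [Algebra k K]

namespace Place

instance (v : Place k K) : IsDiscreteValuationRing v.ring := v.isDVR

/-- The normalised multiplicative valuation: `v.val f = exp (-ord_v f)` for `f ≠ 0`. -/
def val (v : Place k K) : Valuation K (WithZero (Multiplicative ℤ)) :=
  (IsDiscreteValuationRing.maximalIdeal v.ring).valuation K

instance (v : Place k K) : Algebra k v.ring :=
  ((algebraMap k K).codRestrict v.ring v.const_mem).toAlgebra

/-- The degree of a closed point: the degree of its residue field over `k`. -/
def degree (v : Place k K) : ℕ := Module.finrank k (IsLocalRing.ResidueField v.ring)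

theorem val_const_le (v : Place k K) (c : k) : v.val (algebraMap k K c) ≤ 1 :=
  (IsDiscreteValuationRing.maximalIdeal v.ring).valuation_le_one
    (⟨algebraMap k K c, v.const_mem c⟩ : v.ring)

theorem val_smul_le (v : Place k K) (c : k) (f : K) : v.val (c • f) ≤ v.val f := by
  rw [Algebra.smul_def, map_mul]
  exact mul_le_of_le_one_left' (v.val_const_le c)

end Place

variable (k K) in
/-- Line bundles, as divisors: `D` stands for `𝒪(D)`, whose sections over an open set are the
rational functions `f` with `ord_v f ≥ -D v` for all `v` in that set. The tensor product is `+`,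
the trivial bundle is `0`, the inverse is `-`. -/
abbrev LineBundle : Type u := Place k K →₀ ℤ

namespace LineBundle

/-- The degree of a line bundle. -/
def degree (D : LineBundle k K) : ℤ := D.sum fun v n => n * (v.degree : ℤ)

/-- `𝒪(D)` and `𝒪(D')` are isomorphic: `D - D'` is the divisor of a rational function. -/
def Iso (D D' : LineBundle k K) : Prop :=
  ∃ f : K, f ≠ 0 ∧ ∀ v : Place k K, v.val f = WithZero.exp (D' v - D v)

end LineBundle

/-- `H⁰(𝒪(D))`. -/
def H0 (D : LineBundle k K) : Submodule k K where
  carrier := {f | ∀ v : Place k K, v.val f ≤ WithZero.exp (D v)}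
  zero_mem' := fun v => by simp
  add_mem' := fun {f g} hf hg v => (v.val.map_add f g).trans (max_le (hf v) (hg v))
  smul_mem' := fun c f hf v => (v.val_smul_le c f).trans (hf v)

variable (k K) in
/-- Repartitions: families `(α_v)` of rational functions indexed by the closed points, with `α_v`
regular at `v` for almost all `v`. -/
def Rep : Submodule k (Place k K → K) where
  carrier := {α | {v : Place k K | ¬ v.val (α v) ≤ 1}.Finite}
  zero_mem' := by simp
  add_mem' := fun {α β} hα hβ => (hα.union hβ).subset fun v hv => by
    by_contra h
    simp only [Set.mem_union, Set.mem_ofPred_eq, not_or, not_not] at h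
    exact hv ((v.val.map_add _ _).trans (max_le h.1 h.2))
  smul_mem' := fun c α hα => hα.subset fun v hv h => hv ((v.val_smul_le c (α v)).trans h)

/-- Families `(α_v)` with `α_v` in the stalk of `𝒪(D)` at `v` for all `v`. -/
def locSec (D : LineBundle k K) : Submodule k (Place k K → K) where
  carrier := {α | ∀ v : Place k K, v.val (α v) ≤ WithZero.exp (D v)}
  zero_mem' := fun v => by simp
  add_mem' := fun {α β} hα hβ v => (v.val.map_add _ _).trans (max_le (hα v) (hβ v))
  smul_mem' := fun c α hα v => (v.val_smul_le c (α v)).trans (hα v)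

variable (k K) in
/-- The constant families, i.e. `K` embedded diagonally. -/
def constRep : Submodule k (Place k K → K) :=
  LinearMap.range (LinearMap.pi fun _ : Place k K => (LinearMap.id : K →ₗ[k] K))

/-- The repartitions in `𝔸(D) + K`. -/
def coboundary (D : LineBundle k K) : Submodule k (Rep k K) :=
  (locSec D ⊔ constRep k K).comap (Rep k K).subtype

/-- `H¹(𝒪(D)) = 𝔸 / (𝔸(D) + K)`, the cokernel of `K → ⨁_v K / 𝒪(D)_v`. -/
abbrev H1 (D : LineBundle k K) : Type u := Rep k K ⧸ coboundary D

/-- `H⁰(𝒪(D)) = H⁰(𝒪(D'))` for `D = D'`. -/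
def H0.cast {D D' : LineBundle k K} (h : D = D') (f : H0 D) : H0 D' := ⟨f.1, h ▸ f.2⟩

/-- `H¹(𝒪(D)) = H¹(𝒪(D'))` for `D = D'`. -/
def H1.cast {D D' : LineBundle k K} (h : D = D') : H1 D ≃ₗ[k] H1 D' :=
  Submodule.quotEquivOfEq _ _ (by rw [h])

/-- The product `H⁰(𝒪(D)) × H⁰(𝒪(D')) → H⁰(𝒪(D + D'))`. -/
def mul00 {D D' : LineBundle k K} (f : H0 D) (g : H0 D') : H0 (D + D') :=
  ⟨f.1 * g.1, fun v => by
    rw [map_mul, Finsupp.add_apply, WithZero.exp_add]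
    exact mul_le_mul' (f.2 v) (g.2 v)⟩

/-- Multiplication of repartitions by a section of `𝒪(D)`. -/
def repMul {D : LineBundle k K} (f : H0 D) : Rep k K →ₗ[k] Rep k K where
  toFun α := ⟨fun v => f.1 * α.1 v, by
    refine (Set.Finite.union α.2 D.support.finite_toSet).subset fun v hv => ?_
    by_contra h
    simp only [Set.mem_union, Set.mem_ofPred_eq, not_or, not_not, Finset.mem_coe,
      Finsupp.mem_support_iff] at h
    apply hv
    have hf := f.2 v
    rw [h.2, WithZero.exp_zero] at hf
    rw [map_mul]
    exact mul_le_one' hf h.1⟩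
  map_add' α β := Subtype.ext <| funext fun v => mul_add _ _ _
  map_smul' c α := Subtype.ext <| funext fun v => mul_smul_comm _ _ _

/-- The product `H⁰(𝒪(D)) × H¹(𝒪(D')) → H¹(𝒪(D + D'))`. -/
def mul01 {D D' : LineBundle k K} (f : H0 D) : H1 D' →ₗ[k] H1 (D + D') :=
  Submodule.mapQ (coboundary D') (coboundary (D + D')) (repMul f) (by
    rintro ⟨α, hα⟩ h
    obtain ⟨β, hβ, γ, ⟨c, rfl⟩, hs⟩ := Submodule.mem_sup.1 h
    refine Submodule.mem_sup.2 ⟨fun v => f.1 * β v, fun v => ?_, _, ⟨f.1 * c, rfl⟩, ?_⟩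
    · rw [map_mul, Finsupp.add_apply, WithZero.exp_add]
      exact mul_le_mul' (f.2 v) (hβ v)
    · funext v
      have hv := congrFun hs v
      simp only [Pi.add_apply, LinearMap.pi_apply, LinearMap.id_apply,
        Submodule.subtype_apply] at hv
      simp only [Pi.add_apply, LinearMap.pi_apply, LinearMap.id_apply, Submodule.subtype_apply,
        repMul, LinearMap.coe_mk, AddHom.coe_mk, ← hv, mul_add])

/-- The product `H¹(𝒪(D)) × H⁰(𝒪(D')) → H¹(𝒪(D + D'))`. -/
def mul10 {D D' : LineBundle k K} (x : H1 D) (g : H0 D') : H1 (D + D') :=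
  H1.cast (add_comm D' D) (mul01 g x)

/-! ## The graded category of line bundles -/

/-- The graded space of morphisms `Hom*(X, Y) = H*(X⁻¹Y) = H⁰(X⁻¹Y) ⊕ H¹(X⁻¹Y)`. -/
abbrev Hom (X Y : LineBundle k K) : Type u := H0 (Y - X) × H1 (Y - X)

/-- The component of degree `i` of `Hom*(X, Y)`. -/
def homog (X Y : LineBundle k K) (i : ℤ) : Submodule k (Hom X Y) :=
  if i = 0 then Submodule.prod ⊤ ⊥ else if i = 1 then Submodule.prod ⊥ ⊤ else ⊥

/-- A class in `H⁰(L)` as a morphism of degree `0` from `X` to `Y ≃ XL`. -/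
def Hom.of0 {L X Y : LineBundle k K} (h : L = Y - X) (s : H0 L) : Hom X Y := (H0.cast h s, 0)

/-- A class in `H¹(L)` as a morphism of degree `1` from `X` to `Y ≃ XL`. -/
def Hom.of1 {L X Y : LineBundle k K} (h : L = Y - X) (e : H1 L) : Hom X Y := (0, H1.cast h e)

/-- The standard composition `Hom*(X, Y) × Hom*(Y, Z) → Hom*(X, Z)` (products of two classes
of degree one vanish on a curve). -/
def comp {X Y Z : LineBundle k K} (a : Hom X Y) (b : Hom Y Z) : Hom X Z :=
  have h : Y - X + (Z - Y) = Z - X := by abel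
  (H0.cast h (mul00 a.1 b.1), H1.cast h (mul01 a.1 b.2) + H1.cast h (mul10 a.2 b.1))

/-- The functor of tensor multiplication by `N`, on morphisms. -/
def tensor (N : LineBundle k K) {X Y : LineBundle k K} (a : Hom X Y) : Hom (X + N) (Y + N) :=
  have h : Y - X = Y + N - (X + N) := by abel
  (H0.cast h a.1, H1.cast h a.2)

/-- The functor of tensor multiplication by `N`, on chains. -/
def tensorChain (N : LineBundle k K) :
    {X Y : LineBundle k K} → Chain Hom X Y → Chain Hom (X + N) (Y + N)
  | _, _, Chain.nil X => Chain.nil (X + N)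
  | _, _, Chain.cons a p => Chain.cons (tensor N a) (tensorChain N p)

variable (k K) in
/-- The global sections of the dualising sheaf, as Weil differentials: the linear functionals on
repartitions that vanish on `𝔸(0) + K`. On a curve of genus one, where the dualising sheaf is
trivial, its trivialisations are the non-zero ones. -/
abbrev RegularDifferential : Type u := H1 (0 : LineBundle k K) →ₗ[k] k

/-- The Serre duality pairing `Hom*(X, Y) × Hom*(Y, X) → k` given by `τ`. -/
def serre (τ : RegularDifferential k K) {X Y : LineBundle k K} (a : Hom X Y) (b : Hom Y X) : k :=
  τ (H1.cast (sub_self X) (comp a b).2)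

/-- `a₁, …, aₙ` are homogeneous of degrees `d₁, …, dₙ`. -/
def HasDegrees : {X Y : LineBundle k K} → Chain Hom X Y → List ℤ → Prop
  | _, _, Chain.nil _, [] => True
  | X, _, Chain.cons (Y := Y) a p, d :: ds => a ∈ homog X Y d ∧ HasDegrees p ds
  | _, _, Chain.nil _, _ :: _ => False
  | _, _, Chain.cons _ _, [] => False

/-! ## Transversality -/

/-- A notion of transversality for pairs of line bundles, compatible with duals and tensor products. -/
structure Transversality (k K : Type u) [Field k] [Field K] [Algebra k K] where
  /-- the pair `(L, M)` is transversal -/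
  rel : LineBundle k K → LineBundle k K → Prop
  symm : ∀ L M, rel L M ↔ rel M L
  inv : ∀ L M, rel L M ↔ rel (-L) (-M)
  tensor : ∀ L₁ L₂ M, rel L₁ L₂ ↔ rel (L₁ + M) (L₂ + M)
  /-- Among the bundles of degree `d` such that `L` and `L²` are transversal to all bundles of a
  given finite collection there are infinitely many pairwise non-isomorphic ones. -/
  infinite : ∀ (F : Finset (LineBundle k K)) (d : ℤ), ∃ S : Set (LineBundle k K), S.Infinite ∧
    (S.Pairwise fun L L' => ¬ L.Iso L') ∧
    ∀ L ∈ S, L.degree = d ∧ ∀ N ∈ F, rel L N ∧ rel (L + L) N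
  not_iso : ∀ L M, rel L M → ¬ L.Iso M

/-- A collection `(X₀, …, Xₙ)` is transversal if all pairs `(X_i, X_j)`, `i < j`, are. -/
def Transversality.Coll (T : Transversality k K) (l : List (LineBundle k K)) : Prop :=
  l.Pairwise T.rel

/-! ## Transversal `A∞`-structures -/

/-- `(-1)^n` acting on a vector space. -/
def sgn {V : Type w} [AddCommGroup V] (n : ℤ) (x : V) : V := n.negOnePow • x

/-- The left hand side of the `A∞`-constraint for `(a₁, …, aₙ)` of degrees `ds`: the sum over all
`(a₁, …, aₙ) = (p, q, r)` with `q` non-empty, where `p = (a₁, …, a_{j-1})` and `q` has length `l`,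
of the terms `(-1)^{l(ã₁ + ⋯ + ã_{j-1}) + j(l+1)} m_k(p, m_l(q), r)`. -/
def axiomSum (m : ∀ {X Y : LineBundle k K}, Chain Hom X Y → Hom X Y) {X Y : LineBundle k K}
    (c : Chain Hom X Y) (ds : List ℤ) : Hom X Y :=
  (c.splits.map fun s => (s.2.2.splits.map fun t =>
    let p := s.2.1
    let q := t.2.1
    let r := t.2.2
    if q.length = 0 then 0
    else sgn (q.length * (ds.take p.length).sum + (p.length + 1) * (q.length + 1))
      (m (p.append (Chain.cons (m q) r)))).sum).sum

/-- The family is linear in each argument (on transversal collections). -/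
def IsMultilinear (T : Transversality k K)
    (m : ∀ {X Y : LineBundle k K}, Chain Hom X Y → Hom X Y) : Prop :=
  ∀ {X Y Z W : LineBundle k K} (p : Chain Hom X Y) (q : Chain Hom Z W) (a₀ : Hom Y Z),
    T.Coll (p.append (Chain.cons a₀ q)).objects →
    IsLinearMap k fun a : Hom Y Z => m (p.append (Chain.cons a q))

/-- The `n`-ary member of the family has degree `c - n` (on transversal collections). -/
def HasDegree (T : Transversality k K)
    (m : ∀ {X Y : LineBundle k K}, Chain Hom X Y → Hom X Y) (c : ℤ) : Prop :=
  ∀ {X Y : LineBundle k K} (p : Chain Hom X Y) (ds : List ℤ), T.Coll p.objects → p.length ≠ 0 →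
    HasDegrees p ds → m p ∈ homog X Y (ds.sum + c - p.length)

/-- A transversal `A∞`-structure on the line bundles, with morphism spaces `Hom*(X, Y)`:
products `m_n(a₁, …, a_n)` of degree `2 - n` for transversal collections, satisfying the
`A∞`-constraints. The values of `m` on chains that are not transversal, or empty, carry no
information. -/
structure AInfStructure (T : Transversality k K) where
  /-- `m (a₁, …, aₙ) = m_n(a₁, …, aₙ)` -/
  m : ∀ {X Y : LineBundle k K}, Chain Hom X Y → Hom X Y
  multilinear : IsMultilinear T m
  degree : HasDegree T m 2
  constraint : ∀ {X Y : LineBundle k K} (p : Chain Hom X Y) (ds : List ℤ), T.Coll p.objects →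
    HasDegrees p ds → axiomSum m p ds = 0

/-- Admissibility: `m₁ = 0`, `m₂` is the standard composition, tensor multiplication by a line
bundle is strictly compatible with `m`, and `m` is cyclic for the Serre duality given by `τ`. -/
structure AInfStructure.IsAdmissible {T : Transversality k K} (A : AInfStructure T)
    (τ : RegularDifferential k K) : Prop where
  m_one : ∀ {X Y : LineBundle k K} (a : Hom X Y), T.rel X Y → A.m (Chain.single a) = 0
  m_two : ∀ {X Y Z : LineBundle k K} (a : Hom X Y) (b : Hom Y Z), T.Coll [X, Y, Z] →
    A.m (Chain.cons a (Chain.single b)) = comp a b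
  m_tensor : ∀ (N : LineBundle k K) {X Y : LineBundle k K} (p : Chain Hom X Y),
    T.Coll p.objects → p.length ≠ 0 → A.m (tensorChain N p) = tensor N (A.m p)
  /-- `b(m_n(a₁, …, aₙ), a_{n+1}) = (-1)^{n(ã₁+1)} b(a₁, m_n(a₂, …, a_{n+1}))`, where
  `p = (a₂, …, aₙ)` and `c = a_{n+1}` -/
  cyclic : ∀ {X Y Z : LineBundle k K} (a : Hom X Y) (p : Chain Hom Y Z) (c : Hom Z X) (d : ℤ),
    T.Coll (X :: p.objects) → a ∈ homog X Y d →
    serre τ (A.m (Chain.cons a p)) c =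
      sgn ((p.length + 1) * (d + 1)) (serre τ a (A.m (p.append (Chain.single c))))

/-! ## Homotopies -/

/-- `μ(a₁, …, a_k) = (k-1)ã₁ + (k-2)ã₂ + ⋯ + ã_{k-1} + k(k-1)/2`, from the list of degrees. -/
def mu : List ℤ → ℤ
  | [] => 0
  | d :: ds => ds.length * d + ds.length + mu ds

/-- The left hand side `∑ (-1)^{ε_L} m'_i(f(a₁, …), …, f(…, aₙ))` of the equation for an
`A∞`-morphism, where `f` of a block of degrees `b₁, …, b_r` has degree `b₁ + ⋯ + b_r + 1 - r`. -/
def morphismLeft (m' f : ∀ {X Y : LineBundle k K}, Chain Hom X Y → Hom X Y)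
    {X Y : LineBundle k K} (c : Chain Hom X Y) (ds : List ℤ) : Hom X Y :=
  (c.blocks.map fun P =>
    let bs : List (List ℤ) := P.blockLengths.splitLengths ds
    sgn ((bs.map mu).sum + mu (bs.map fun b => b.sum + 1 - b.length)) (m' (P.map f))).sum

/-- The right hand side `∑ (-1)^{ε_R} f_k(a₁, …, a_{j-1}, m_l(a_j, …), …, aₙ)` of the equation
for an `A∞`-morphism. -/
def morphismRight (m f : ∀ {X Y : LineBundle k K}, Chain Hom X Y → Hom X Y)
    {X Y : LineBundle k K} (c : Chain Hom X Y) (ds : List ℤ) : Hom X Y :=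
  (c.splits.map fun s => (s.2.2.splits.map fun t =>
    let p := s.2.1
    let q := t.2.1
    let r := t.2.2
    let dp := ds.take p.length
    let dq := (ds.drop p.length).take q.length
    let dr := (ds.drop p.length).drop q.length
    if q.length = 0 then 0
    else sgn (dp.sum + p.length + mu dq + mu (dp ++ (dq.sum + 2 - q.length) :: dr))
      (f (p.append (Chain.cons (m q) r)))).sum).sum

/-- A homotopy between two transversal `A∞`-structures: an `A∞`-morphism `(f_n)` on transversal
collections which is the identity on objects and has `f₁ = id`. -/
structure Homotopy {T : Transversality k K} (A A' : AInfStructure T) where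
  /-- `f (a₁, …, aₙ) = f_n(a₁, …, aₙ)` -/
  f : ∀ {X Y : LineBundle k K}, Chain Hom X Y → Hom X Y
  f_one : ∀ {X Y : LineBundle k K} (a : Hom X Y), T.rel X Y → f (Chain.single a) = a
  multilinear : IsMultilinear T f
  degree : HasDegree T f 1
  morphism : ∀ {X Y : LineBundle k K} (p : Chain Hom X Y) (ds : List ℤ), T.Coll p.objects →
    p.length ≠ 0 → HasDegrees p ds → morphismLeft A'.m f p ds = morphismRight A.m f p ds

/-! ## Triple products -/

/-- The triple product `m₃ : H⁰(L₁) ⊗ H¹(M) ⊗ H⁰(L₂) → H⁰(L₁ M L₂)`, defined by the chain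
`𝒪 ⟶ L₁ ⟶ L₁M ⟶ L₁ML₂`. -/
def AInfStructure.m3 {T : Transversality k K} (A : AInfStructure T) {L₁ M L₂ : LineBundle k K}
    (s₁ : H0 L₁) (e : H1 M) (s₂ : H0 L₂) : H0 (L₁ + M + L₂) :=
  H0.cast (sub_zero _)
    (A.m (Chain.cons (Hom.of0 (X := 0) (Y := L₁) (sub_zero L₁).symm s₁)
      (Chain.cons (Hom.of1 (X := L₁) (Y := L₁ + M) (add_sub_cancel_left L₁ M).symm e)
        (Chain.single (Hom.of0 (X := L₁ + M) (Y := L₁ + M + L₂)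
          (add_sub_cancel_left (L₁ + M) L₂).symm s₂))))).1

end Curve

end LineBundleAInf

end

/-! The engine is a vanishing statement. If `X` and `Y` have the same degree and are not isomorphic,
then `Hom*(X, Y) = 0`. A nonzero section of a bundle of degree zero has no zeros and would be an
isomorphism, so `H⁰` vanishes; then `H¹` vanishes because Euler characteristics equal degrees.
Transversal pairs are not isomorphic, so this applies to every pair of objects of equal degree in a
transversal chain (`GenusOne.subsingleton_Hom`).

For the identity, the objects `X₀, …, X₅` have degrees `0, n', n, 0, n', n`, so three of the spaces
`Hom*(X_i, X_{i+3})` are zero. Since `m₁ = 0`, the `A∞`-relation on four arguments involves only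
`m₂` and `m₃`. Three instances of it lose most of their terms and combine to the formula
(`triple_mul`). For homotopy invariance, the same vanishing kills every term containing `f₂`, and
`f₃` vanishes for degree reasons (`Homotopy.triple_eq`).

For the reduction, a section of a bundle of degree at least two is a sum of two products with a
factor from a bundle of degree one, and that bundle can be kept transversal to any finite collection
(`exists_section_decomposition`). Expanding `s₁` and `s₂` in this way and applying the identity with
`n' = 1` leaves one product of degrees `(1, -1, 1)` and one of degree one less than before;
induction finishes.

The geometric input is `genusOne`: on an elliptic curve `χ(𝒪(D)) = deg D`, in terms of places and
repartitions. Adding a place to `D` changes both sides by the degree of the place, so a single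
divisor suffices. For the point at infinity `h⁰ = 1` and `h¹ = 0` are computed directly. This
requires knowing all places: they are centred on primes of the coordinate ring, which is Dedekind by
nonsingularity, except for the one at infinity. -/

noncomputable section

namespace LineBundleAInf
open IsDiscreteValuationRing
universe u
variable {k K : Type u} [Field k] [Field K] [Algebra k K]

/-! ### Places and their normalised valuations. -/

namespace Place
variable (v : Place k K)

theorem mem_ring_iff {f : K} : f ∈ v.ring ↔ v.val f ≤ 1 := by
  constructor
  · intro h
    exact (maximalIdeal v.ring).valuation_le_one (⟨f, h⟩ : v.ring)
  · intro h
    obtain ⟨a, rfl⟩ := exists_lift_of_le_one h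
    exact a.2

theorem exists_val_eq (n : ℤ) : ∃ t : K, t ≠ 0 ∧ v.val t = WithZero.exp n := by
  obtain ⟨t, ht⟩ := (maximalIdeal v.ring).valuation_surjective K (WithZero.exp n)
  refine ⟨t, ?_, ht⟩
  rintro rfl
  rw [map_zero] at ht
  exact WithZero.exp_ne_zero ht.symm

theorem residue_eq_zero_iff (u : v.ring) :
    IsLocalRing.residue v.ring u = 0 ↔ v.val (u : K) < 1 := by
  rw [IsLocalRing.residue_eq_zero_iff]
  exact ((maximalIdeal v.ring).valuation_lt_one_iff_mem (K := K) u).symm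

instance : IsScalarTower k v.ring K := IsScalarTower.of_algebraMap_eq (fun _ => rfl)

theorem degree_pos [Module.Finite k (IsLocalRing.ResidueField v.ring)] : 0 < v.degree := by
  unfold degree
  exact Module.finrank_pos

theorem val_const {c : k} (hc : c ≠ 0) : v.val (algebraMap k K c) = 1 := by
  refine le_antisymm (v.val_const_le c) ?_
  have h := v.val_const_le c⁻¹
  have h2 : v.val (algebraMap k K c) * v.val (algebraMap k K c⁻¹) = 1 := by
    rw [← map_mul, ← map_mul, mul_inv_cancel₀ hc, map_one, map_one]
  rw [← h2]
  exact mul_le_of_le_one_right' h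

theorem ext_ring {v w : Place k K} (h : v.ring = w.ring) : v = w := by
  cases v; cases w; simp_all

end Place

/-! ### The cohomology sequence of adding a point to a divisor. -/

/-- The residue map at `v`, as a `k`-linear map. -/
def residueₗ (v : Place k K) : v.ring →ₗ[k] IsLocalRing.ResidueField v.ring :=
  (IsScalarTower.toAlgHom k v.ring (IsLocalRing.ResidueField v.ring)).toLinearMap

theorem residueₗ_apply (v : Place k K) (x) : residueₗ v x = IsLocalRing.residue v.ring x := rfl

theorem mk_eq_zero_iff {D : LineBundle k K} (α : Rep k K) :
    (Submodule.Quotient.mk α : H1 D) = 0 ↔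
      ∃ c : K, ∀ v, v.val (α.1 v - c) ≤ WithZero.exp (D v) := by
  rw [Submodule.Quotient.mk_eq_zero]
  constructor
  · intro h
    obtain ⟨β, hβ, γ, ⟨c, rfl⟩, hs⟩ := Submodule.mem_sup.1 h
    refine ⟨c, fun v => ?_⟩
    have : α.1 v - c = β v := by
      have := congrFun hs v
      simp at this
      rw [← this]; ring
    rw [this]
    exact hβ v
  · rintro ⟨c, hc⟩
    refine Submodule.mem_sup.2 ⟨fun v => α.1 v - c, hc, fun _ => c, ⟨c, rfl⟩, ?_⟩
    funext v
    simp

open Classical in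
/-- The repartition with value `a` at `v` and zero elsewhere. -/
def singleRep (v : Place k K) : K →ₗ[k] Rep k K :=
  LinearMap.codRestrict (Rep k K) (LinearMap.single k (fun _ : Place k K => K) v) (by
    intro a
    refine (Set.finite_singleton v).subset fun w hw => ?_
    by_contra h
    apply hw
    simp [Pi.single_eq_of_ne h])

open Classical in
theorem singleRep_apply (v w : Place k K) (a : K) :
    (singleRep v a).1 w = if w = v then a else 0 :=
  Pi.single_apply v a w

/-- Additivity of dimensions along `0 → A → B → C → E → F → 0`. Finiteness passes in both
directions, so that a point can be removed from a divisor as well as added. -/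
theorem exact_finite {A B C E F : Type*} [AddCommGroup A] [AddCommGroup B] [AddCommGroup C]
    [AddCommGroup E] [AddCommGroup F] [Module k A] [Module k B] [Module k C] [Module k E]
    [Module k F] [Module.Finite k C] {f : A →ₗ[k] B} {φ : B →ₗ[k] C} {ψ : C →ₗ[k] E}
    {ρ : E →ₗ[k] F} (hf : Function.Injective f) (h₁ : Function.Exact f φ)
    (h₂ : Function.Exact φ ψ) (h₃ : Function.Exact ψ ρ) (hρ : Function.Surjective ρ) :
    (Module.Finite k A ∧ Module.Finite k E ↔ Module.Finite k B ∧ Module.Finite k F) ∧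
    (Module.Finite k A ∧ Module.Finite k E → (Module.finrank k B : ℤ) - Module.finrank k F =
      Module.finrank k A - Module.finrank k E + Module.finrank k C) := by
  have fin : Module.Finite k A ∧ Module.Finite k E ↔ Module.Finite k B ∧ Module.Finite k F := by
    constructor
    · rintro ⟨_, _⟩
      exact ⟨.of_exact (g := φ.rangeRestrict) (fun x => (Subtype.ext_iff.trans (h₁ x)))
        φ.surjective_rangeRestrict, .of_surjective ρ hρ⟩
    · rintro ⟨_, _⟩
      exact ⟨.of_injective f hf, .of_exact h₃ hρ⟩
  refine ⟨fin, fun h => ?_⟩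
  obtain ⟨_, _⟩ := h
  obtain ⟨_, _⟩ := fin.1 ⟨‹_›, ‹_›⟩
  have e1 := LinearMap.finrank_range_add_finrank_ker φ
  have e2 := LinearMap.finrank_range_add_finrank_ker ψ
  have e3 := LinearMap.finrank_range_add_finrank_ker ρ
  rw [LinearMap.exact_iff.1 h₁, LinearMap.finrank_range_of_inj hf] at e1
  rw [LinearMap.exact_iff.1 h₂] at e2
  rw [LinearMap.exact_iff.1 h₃, LinearMap.range_eq_top.2 hρ, finrank_top] at e3
  omega

theorem H0_mono {D D' : LineBundle k K} (h : D ≤ D') : H0 D ≤ H0 D' := fun _ hf v =>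
  (hf v).trans (WithZero.exp_le_exp.2 (h v))

theorem coboundary_mono {D D' : LineBundle k K} (h : D ≤ D') : coboundary D ≤ coboundary D' :=
  Submodule.comap_mono (sup_le_sup_right (fun _ hα v =>
    (hα v).trans (WithZero.exp_le_exp.2 (h v))) _)

theorem le_exp_iff_lt_exp_add_one {x : WithZero (Multiplicative ℤ)} {n : ℤ} :
    x ≤ WithZero.exp n ↔ x < WithZero.exp (n + 1) := by
  induction x using WithZero.expRecOn with
  | zero => simp
  | exp a => rw [WithZero.exp_le_exp, WithZero.exp_lt_exp]; omega

/-- This is the long exact sequence of `0 → 𝒪(D) → 𝒪(D + v) → κ(v) → 0`, with `ψ` the connecting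
map. -/
theorem exact_place (D : LineBundle k K) (v : Place k K) :
    ∃ (φ : H0 (D + Finsupp.single v 1) →ₗ[k] IsLocalRing.ResidueField v.ring)
      (ψ : IsLocalRing.ResidueField v.ring →ₗ[k] H1 D)
      (h : D ≤ D + Finsupp.single v 1),
      Function.Exact (Submodule.inclusion (H0_mono h)) φ ∧ Function.Exact φ ψ ∧
      Function.Exact ψ (Submodule.factor (coboundary_mono h)) := by
  classical
  -- `t` generates the stalk of `𝒪(D + v)` at `v`: for `f` in that stalk `t⁻¹ f` is integral, and
  -- its residue is zero exactly when `f` lies in the stalk of `𝒪(D)`.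
  obtain ⟨t, ht0, ht⟩ := v.exists_val_eq (D v + 1)
  have h : D ≤ D + Finsupp.single v 1 := by
    refine le_add_of_nonneg_right fun w => ?_
    by_cases hw : v = w
    · subst hw; simp
    · simp [hw]
  have hDv : (D + Finsupp.single v 1 : LineBundle k K) v = D v + 1 := by simp
  have hDw : ∀ w, w ≠ v → (D + Finsupp.single v 1 : LineBundle k K) w = D w := fun w hw => by
    simp [Finsupp.single_eq_of_ne hw]
  have key : ∀ f : K, v.val f ≤ WithZero.exp (D v + 1) → t⁻¹ * f ∈ v.ring := fun f hf => by
    rw [v.mem_ring_iff, map_mul, map_inv₀, ht]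
    refine (mul_le_mul_right hf _).trans (le_of_eq ?_)
    exact inv_mul_cancel₀ WithZero.exp_ne_zero
  have key2 : ∀ f : K, v.val (t⁻¹ * f) < 1 ↔ v.val f ≤ WithZero.exp (D v) := fun f => by
    rw [le_exp_iff_lt_exp_add_one, map_mul, map_inv₀, ht,
      ← mul_lt_mul_iff_right₀ (WithZero.exp_pos (a := D v + 1)),
      mul_inv_cancel_left₀ WithZero.exp_ne_zero, mul_one]
  let φ : H0 (D + Finsupp.single v 1) →ₗ[k] IsLocalRing.ResidueField v.ring := residueₗ v ∘ₗ
    { toFun := fun f => ⟨t⁻¹ * f.1, key _ (hDv ▸ f.2 v)⟩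
      map_add' := fun f g => Subtype.ext (mul_add _ _ _)
      map_smul' := fun c f => Subtype.ext (by
        change t⁻¹ * (c • f.1) = algebraMap k K c * (t⁻¹ * f.1)
        rw [Algebra.smul_def]
        ring) }
  -- The connecting map on representatives: `u` gives the repartition with value `t u` at `v` and
  -- zero elsewhere.
  let ψ₀ : v.ring →ₗ[k] H1 D := (coboundary D).mkQ ∘ₗ singleRep v ∘ₗ
    { toFun := fun u => t * u.1
      map_add' := fun f g => mul_add _ _ _
      map_smul' := fun c f => by
        change t * (algebraMap k K c * f.1) = c • (t * f.1)
        rw [Algebra.smul_def]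
        ring }
  have hsurj : Function.Surjective (residueₗ v) := IsLocalRing.residue_surjective
  -- `ψ₀` kills the maximal ideal (`hker`), so composing it with any linear section of the residue
  -- map is the descended map (`hψ`).
  obtain ⟨σ, hσ⟩ := LinearMap.exists_rightInverse_of_surjective (residueₗ v)
    (LinearMap.range_eq_top.2 hsurj)
  have hψ₀ : ∀ u : v.ring, ψ₀ u = 0 ↔
      ∃ c : K, ∀ w, w.val ((if w = v then t * u.1 else 0) - c) ≤ WithZero.exp (D w) := by
    intro u
    refine (mk_eq_zero_iff _).trans ?_
    refine exists_congr fun c => forall_congr' fun w => ?_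
    rw [← singleRep_apply]
    rfl
  have hker : ∀ u : v.ring, residueₗ v u = 0 → ψ₀ u = 0 := by
    intro u hu
    refine (hψ₀ u).2 ⟨0, fun w => ?_⟩
    rw [residueₗ_apply, v.residue_eq_zero_iff] at hu
    by_cases hw : w = v
    · subst hw
      rw [if_pos rfl, sub_zero, ← key2, inv_mul_cancel_left₀ ht0]
      exact hu
    · simp [if_neg hw]
  have hψ : ∀ u : v.ring, (ψ₀ ∘ₗ σ) (residueₗ v u) = ψ₀ u := by
    intro u
    have h1 : residueₗ v (σ (residueₗ v u) - u) = 0 := by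
      rw [map_sub, sub_eq_zero]
      exact LinearMap.congr_fun hσ _
    have h2 := hker _ h1
    rw [map_sub, sub_eq_zero] at h2
    exact h2
  refine ⟨φ, ψ₀ ∘ₗ σ, h, ?_, ?_, ?_⟩
  · intro f
    have : φ f = 0 ↔ v.val (t⁻¹ * f.1) < 1 := v.residue_eq_zero_iff _
    rw [this, key2]
    constructor
    · intro hf
      refine ⟨⟨f.1, fun w => ?_⟩, rfl⟩
      by_cases hw : w = v
      · subst hw; exact hf
      · have := f.2 w
        rwa [hDw w hw] at this
    · rintro ⟨g, rfl⟩
      exact g.2 v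
  · intro x
    obtain ⟨u, rfl⟩ := hsurj x
    rw [hψ, hψ₀]
    constructor
    · rintro ⟨c, hc⟩
      have hcv := hc v
      rw [if_pos rfl] at hcv
      have hc' : c ∈ H0 (D + Finsupp.single v 1) := by
        intro w
        by_cases hw : w = v
        · subst hw
          rw [hDv]
          have e : c = t * u.1 - (t * u.1 - c) := by ring
          rw [e]
          refine (w.val.map_sub _ _).trans (max_le ?_ (hcv.trans ?_))
          · rw [map_mul, ht]
            exact mul_le_of_le_one_right' (w.mem_ring_iff.1 u.2)
          · rw [WithZero.exp_le_exp]; omega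
        · have := hc w
          rw [if_neg hw, zero_sub, Valuation.map_neg] at this
          rwa [hDw w hw]
      refine ⟨⟨c, hc'⟩, ?_⟩
      rw [← sub_eq_zero]
      change residueₗ v _ - _ = 0
      rw [← map_sub, residueₗ_apply, v.residue_eq_zero_iff]
      change v.val (t⁻¹ * c - u.1) < 1
      rw [← Valuation.map_neg, ← inv_mul_cancel_left₀ ht0 u.1, ← mul_sub, ← mul_neg, neg_sub, key2]
      exact hcv
    · rintro ⟨f, hf⟩
      refine ⟨f.1, fun w => ?_⟩
      by_cases hw : w = v
      · subst hw
        rw [if_pos rfl]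
        rw [← sub_eq_zero] at hf
        change residueₗ w _ - _ = 0 at hf
        rw [← map_sub, residueₗ_apply, w.residue_eq_zero_iff] at hf
        change w.val (t⁻¹ * f.1 - u.1) < 1 at hf
        rw [← Valuation.map_neg, ← inv_mul_cancel_left₀ ht0 u.1, ← mul_sub, ← mul_neg, neg_sub,
          key2] at hf
        exact hf
      · rw [if_neg hw, zero_sub, Valuation.map_neg]
        have := f.2 w
        rwa [hDw w hw] at this
  · intro x
    obtain ⟨α, rfl⟩ := Submodule.Quotient.mk_surjective _ x
    have e : (Submodule.factor (coboundary_mono h)) (Submodule.Quotient.mk α : H1 D) =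
      (Submodule.Quotient.mk α : H1 (D + Finsupp.single v 1)) := rfl
    rw [e, mk_eq_zero_iff]
    constructor
    · rintro ⟨c, hc⟩
      have hu := key _ (hDv ▸ hc v)
      refine ⟨residueₗ v ⟨_, hu⟩, ?_⟩
      rw [hψ]
      change Submodule.Quotient.mk _ = Submodule.Quotient.mk _
      rw [← sub_eq_zero, ← Submodule.Quotient.mk_sub, mk_eq_zero_iff]
      refine ⟨-c, fun w => ?_⟩
      change w.val ((singleRep v (t * (t⁻¹ * (α.1 v - c)))).1 w - α.1 w - -c) ≤ _
      rw [singleRep_apply, mul_inv_cancel_left₀ ht0]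
      by_cases hw : w = v
      · subst hw
        rw [if_pos rfl]
        have e : α.1 w - c - α.1 w - -c = 0 := by ring
        rw [e, map_zero]
        exact zero_le
      · rw [if_neg hw]
        have e : 0 - α.1 w - -c = -(α.1 w - c) := by ring
        rw [e, Valuation.map_neg]
        have := hc w
        rwa [hDw w hw] at this
    · rintro ⟨y, hy⟩
      obtain ⟨u, rfl⟩ := hsurj y
      rw [hψ] at hy
      change Submodule.Quotient.mk _ = Submodule.Quotient.mk _ at hy
      rw [← sub_eq_zero, ← Submodule.Quotient.mk_sub, mk_eq_zero_iff] at hy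
      obtain ⟨c, hc⟩ := hy
      refine ⟨-c, fun w => ?_⟩
      have hcw := hc w
      change w.val ((singleRep v (t * u.1)).1 w - α.1 w - c) ≤ _ at hcw
      rw [singleRep_apply] at hcw
      by_cases hw : w = v
      · subst hw
        rw [if_pos rfl] at hcw
        have e : α.1 w - -c = t * u.1 - (t * u.1 - α.1 w - c) := by ring
        rw [e, hDv]
        refine (w.val.map_sub _ _).trans (max_le ?_ (hcw.trans ?_))
        · rw [map_mul, ht]
          exact mul_le_of_le_one_right' (w.mem_ring_iff.1 u.2)
        · rw [WithZero.exp_le_exp]; omega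
      · rw [if_neg hw] at hcw
        have e : α.1 w - -c = -(0 - α.1 w - c) := by ring
        rw [e, Valuation.map_neg, hDw w hw]
        exact hcw

/-! ## Riemann–Roch in genus one -/

theorem LineBundle.degree_add (D E : LineBundle k K) : (D + E).degree = D.degree + E.degree :=
  Finsupp.sum_add_index' (fun _ => zero_mul _) (fun _ _ _ => add_mul _ _ _)

theorem LineBundle.degree_single (v : Place k K) (n : ℤ) :
    LineBundle.degree (Finsupp.single v n) = n * v.degree :=
  Finsupp.sum_single_index (zero_mul _)

theorem LineBundle.degree_zero : (0 : LineBundle k K).degree = 0 := Finsupp.sum_zero_index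

theorem LineBundle.degree_neg (D : LineBundle k K) : (-D).degree = -D.degree := by
  have := LineBundle.degree_add D (-D)
  rw [add_neg_cancel, LineBundle.degree_zero] at this
  omega

theorem LineBundle.degree_sub (D E : LineBundle k K) : (D - E).degree = D.degree - E.degree := by
  rw [sub_eq_add_neg, LineBundle.degree_add, LineBundle.degree_neg, sub_eq_add_neg]

/-- The cohomology of `𝒪(D)` is finite-dimensional, with Euler characteristic `deg D`. -/
structure HasEuler (D : LineBundle k K) : Prop where
  finite0 : Module.Finite k (H0 D)
  finite1 : Module.Finite k (H1 D)
  euler : (Module.finrank k (H0 D) : ℤ) - Module.finrank k (H1 D) = D.degree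

theorem hasEuler_add_place_iff (D : LineBundle k K) (v : Place k K)
    [Module.Finite k (IsLocalRing.ResidueField v.ring)] :
    HasEuler (D + Finsupp.single v 1) ↔ HasEuler D := by
  obtain ⟨φ, ψ, h, h₁, h₂, h₃⟩ := exact_place D v
  obtain ⟨e₁, e₂⟩ := exact_finite (Submodule.inclusion_injective _) h₁ h₂ h₃
    (Submodule.factor_surjective _)
  have hd : (D + Finsupp.single v 1).degree = D.degree + v.degree := by
    rw [LineBundle.degree_add, LineBundle.degree_single, one_mul]
  constructor
  · rintro ⟨a, b, c⟩
    have e := e₁.2 ⟨a, b⟩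
    have := e₂ e
    rw [c, hd, Place.degree] at this
    exact ⟨e.1, e.2, by omega⟩
  · rintro ⟨a, b, c⟩
    have e := e₁.1 ⟨a, b⟩
    have := e₂ ⟨a, b⟩
    rw [c] at this
    exact ⟨e.1, e.2, by rw [this, hd, Place.degree]⟩

theorem hasEuler_add_iff (hres : ∀ v : Place k K, Module.Finite k (IsLocalRing.ResidueField v.ring))
    (D E : LineBundle k K) : HasEuler (D + E) ↔ HasEuler D := by
  induction E using Finsupp.induction_linear generalizing D with
  | zero => rw [add_zero]
  | add E F hE hF => rw [← add_assoc, hF, hE]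
  | single v n =>
    have := hres v
    induction n using Int.induction_on with
    | zero => rw [Finsupp.single_zero, add_zero]
    | succ i hi => rw [Finsupp.single_add, ← add_assoc, hasEuler_add_place_iff]; exact hi
    | pred i hi =>
      rw [← hasEuler_add_place_iff _ v, add_assoc, ← Finsupp.single_add, sub_add_cancel]
      exact hi

variable (k K) in
/-- The curve with function field `K / k` satisfies the Riemann–Roch theorem in genus one: Euler
characteristics are degrees. -/
structure GenusOne : Prop where
  finite_residue : ∀ v : Place k K, Module.Finite k (IsLocalRing.ResidueField v.ring)
  hasEuler : ∀ D : LineBundle k K, HasEuler D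

theorem GenusOne.of_hasEuler
    (hres : ∀ v : Place k K, Module.Finite k (IsLocalRing.ResidueField v.ring))
    {D : LineBundle k K} (hD : HasEuler D) : GenusOne k K :=
  ⟨hres, fun E => by rwa [← add_sub_cancel D E, hasEuler_add_iff hres]⟩

theorem mul01_mk {D D' : LineBundle k K} (f : H0 D) (α : Rep k K) :
    mul01 f (Submodule.Quotient.mk α : H1 D') = Submodule.Quotient.mk (repMul f α) := rfl

open Classical in
/-- `f⁻¹ α`, except at the places where `α` is already a section of `𝒪(D)`. -/
def truncDiv (D : LineBundle k K) (f : K) (α : Rep k K) : Rep k K :=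
  ⟨fun v => if v.val (α.1 v) ≤ WithZero.exp (D v) then 0 else f⁻¹ * α.1 v, by
    refine (Set.Finite.union α.2 D.support.finite_toSet).subset fun v hv => ?_
    by_contra h
    simp only [Set.mem_union, Set.mem_ofPred_eq, not_or, not_not, Finset.mem_coe,
      Finsupp.mem_support_iff] at h
    simp [h] at hv⟩

/-- The cokernel of multiplication by `f` on sheaves is a sum of skyscrapers and has no `H¹`.
Concretely one divides a repartition by `f`; the truncation keeps the quotient a repartition without
knowing that `f` has only finitely many zeros. -/
theorem mul01_surjective {D D' : LineBundle k K} {f : H0 D} (hf : f.1 ≠ 0) :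
    Function.Surjective (mul01 f : H1 D' →ₗ[k] H1 (D + D')) := by
  intro x
  obtain ⟨α, rfl⟩ := Submodule.Quotient.mk_surjective _ x
  refine ⟨Submodule.Quotient.mk (truncDiv (D + D') f.1 α), ?_⟩
  rw [mul01_mk, ← sub_eq_zero, ← Submodule.Quotient.mk_sub, mk_eq_zero_iff]
  refine ⟨0, fun v => ?_⟩
  have e : (repMul f (truncDiv (D + D') f.1 α) - α).1 v =
    f.1 * (truncDiv (D + D') f.1 α).1 v - α.1 v := rfl
  rw [e, sub_zero, truncDiv]
  dsimp only
  split_ifs with h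
  · rwa [mul_zero, zero_sub, Valuation.map_neg]
  · rw [mul_inv_cancel_left₀ hf, sub_self, map_zero]
    exact zero_le

/-- Multiplication by `f` is injective on `H⁰` and surjective on `H¹`, so `deg D = χ(D) ≥ χ(0) = 0`.
This replaces the theorem that principal divisors have degree zero. -/
theorem GenusOne.degree_nonneg (G : GenusOne k K) {D : LineBundle k K} {f : K} (hf : f ∈ H0 D)
    (hf0 : f ≠ 0) : 0 ≤ D.degree := by
  let μ : H0 (0 : LineBundle k K) →ₗ[k] H0 (D + 0) :=
    { toFun := fun g => mul00 ⟨f, hf⟩ g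
      map_add' := fun _ _ => Subtype.ext (mul_add _ _ _)
      map_smul' := fun _ _ => Subtype.ext (mul_smul_comm _ _ _) }
  have hμ : Function.Injective μ := fun a b h =>
    Subtype.ext (mul_left_cancel₀ hf0 (congrArg Subtype.val h))
  have h0 := G.hasEuler 0
  have h1 := G.hasEuler (D + 0)
  have := h0.finite0
  have := h0.finite1
  have := h1.finite0
  have := h1.finite1
  have e1 := LinearMap.finrank_le_finrank_of_injective hμ
  have e2 := LinearMap.finrank_le_finrank_of_surjective
    (mul01_surjective (D' := 0) (f := ⟨f, hf⟩) hf0)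
  have e3 := h0.euler
  have e4 := h1.euler
  rw [LineBundle.degree_zero] at e3
  rw [add_zero] at e1 e2 e4
  omega

theorem exists_mem_H0_sub_single {D : LineBundle k K} {f : K} (hf : f ∈ H0 D) :
    (∀ v : Place k K, v.val f = WithZero.exp (D v)) ∨ ∃ v, f ∈ H0 (D - Finsupp.single v 1) := by
  classical
  by_contra! h
  obtain ⟨⟨v, hv⟩, h⟩ := h
  apply h v
  intro w
  by_cases hw : v = w
  · subst hw
    rw [le_exp_iff_lt_exp_add_one, Finsupp.sub_apply, Finsupp.single_eq_same, sub_add_cancel]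
    exact lt_of_le_of_ne (hf v) hv
  · rw [Finsupp.sub_apply, Finsupp.single_eq_of_ne' hw, sub_zero]
    exact hf w

/-- A further zero at `w` would make `f` a section of `D - w`, a divisor of negative degree. -/
theorem GenusOne.val_eq_of_degree_zero (G : GenusOne k K) {D : LineBundle k K} {f : K}
    (hf : f ∈ H0 D) (hf0 : f ≠ 0) (hD : D.degree = 0) (v : Place k K) :
    v.val f = WithZero.exp (D v) := by
  obtain h | ⟨w, hw⟩ := exists_mem_H0_sub_single hf
  · exact h v
  · have := G.finite_residue w
    have h1 := G.degree_nonneg hw hf0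
    have h2 := w.degree_pos
    rw [LineBundle.degree_sub, LineBundle.degree_single] at h1
    omega

theorem GenusOne.H0_eq_bot (G : GenusOne k K) {X Y : LineBundle k K} (h : (Y - X).degree = 0)
    (hXY : ¬ X.Iso Y) : H0 (Y - X) = ⊥ := by
  rw [Submodule.eq_bot_iff]
  intro f hf
  by_contra hf0
  exact hXY ⟨f, hf0, G.val_eq_of_degree_zero hf hf0 h⟩

theorem GenusOne.subsingleton_H1 (G : GenusOne k K) {X Y : LineBundle k K}
    (h : (Y - X).degree = 0) (hXY : ¬ X.Iso Y) : Subsingleton (H1 (Y - X)) := by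
  have e := G.hasEuler (Y - X)
  have := e.finite1
  have e' := e.euler
  rw [G.H0_eq_bot h hXY, finrank_bot, h] at e'
  exact (Module.finrank_zero_iff (R := k)).1 (by omega)

theorem GenusOne.subsingleton_Hom (G : GenusOne k K) {X Y : LineBundle k K}
    (h : (Y - X).degree = 0) (hXY : ¬ X.Iso Y) : Subsingleton (Hom X Y) := by
  have := G.subsingleton_H1 h hXY
  have : Subsingleton (H0 (Y - X)) := by
    rw [G.H0_eq_bot h hXY]
    infer_instance
  infer_instance

end LineBundleAInf

end

/-! ### The coordinate ring of an elliptic curve is a Dedekind domain. -/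

noncomputable section

namespace LineBundleAInf
universe u
open Polynomial

/-- The nonvanishing of `g'(x)` says that `R` is unramified over `A` at `p`, so a generator `h` of
`p ∩ A` also generates `p` locally. The conclusion is this local statement with denominators
cleared. -/
theorem exists_generator_of_derivative_notMem {A R : Type*} [CommRing A] [IsDomain A]
    [IsPrincipalIdealRing A] [CommRing R] [IsDomain R] (φ : A →+* R) {g : A[X]} {x : R}
    (hg : g.Monic) (hgx : g.eval₂ φ x = 0) (hsurj : Function.Surjective (eval₂RingHom φ x))
    {p : Ideal R} [hp : p.IsPrime] (hp0 : p ≠ ⊥) (hd : (derivative g).eval₂ φ x ∉ p) :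
    ∃ h ∈ p, ∀ z ∈ p, ∃ u ∉ p, u * z ∈ Ideal.span {h} := by
  set P := p.comap φ with hPdef
  have hP0 : P ≠ ⊥ := by
    obtain ⟨z, hz, hz0⟩ := Submodule.exists_mem_ne_zero_of_ne_bot hp0
    let _ := φ.toAlgebra
    have hx : IsIntegral A x := ⟨g, hg, hgx⟩
    have hz' : IsIntegral A z := by
      obtain ⟨f, rfl⟩ := hsurj z
      rw [coe_eval₂RingHom, eval₂_eq_sum_range]
      exact IsIntegral.sum _ fun i _ => IsIntegral.mul isIntegral_algebraMap (hx.pow i)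
    exact Ideal.comap_ne_bot_of_integral_mem hz0 hz hz'
  have hPp : P.IsPrime := hp.comap φ
  have hPm : P.IsMaximal := hPp.isMaximal hP0
  obtain ⟨h, hh⟩ := (IsPrincipalIdealRing.principal P).principal
  rw [Ideal.submodule_span_eq] at hh
  let _ : Field (A ⧸ P) := Ideal.Quotient.field P
  let θ : (A ⧸ P)[X] →+* R ⧸ p :=
    eval₂RingHom (Ideal.quotientMap p φ le_rfl) (Ideal.Quotient.mk p x)
  have hθ : ∀ f : A[X], θ (f.map (Ideal.Quotient.mk P)) = Ideal.Quotient.mk p (f.eval₂ φ x) := by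
    intro f
    simp only [θ, coe_eval₂RingHom, eval₂_map, Ideal.quotientMap_comp_mk]
    rw [hom_eval₂]
  have hker : ∀ f : A[X], f.eval₂ φ x ∈ p ↔ f.map (Ideal.Quotient.mk P) ∈ RingHom.ker θ := by
    intro f
    rw [RingHom.mem_ker, hθ, Ideal.Quotient.eq_zero_iff_mem]
  have hzero : ∀ f : A[X], f.map (Ideal.Quotient.mk P) = 0 →
      f.eval₂ φ x ∈ Ideal.span {φ h} := by
    intro f hf
    rw [eval₂_eq_sum_range]
    refine Ideal.sum_mem _ fun i _ => Ideal.mul_mem_right _ _ ?_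
    have : f.coeff i ∈ P := by
      rw [← Ideal.Quotient.eq_zero_iff_mem, ← coeff_map, hf, coeff_zero]
    rw [hh, Ideal.mem_span_singleton] at this
    exact Ideal.mem_span_singleton.2 (map_dvd φ this)
  -- Modulo `P` the polynomials whose value at `x` lies in `p` form a principal ideal `(q)`. Since
  -- it contains `g`, one has `g ≡ q u`.
  obtain ⟨q', hq'⟩ := (IsPrincipalIdealRing.principal (RingHom.ker θ)).principal
  rw [Ideal.submodule_span_eq] at hq'
  have hmap := map_surjective (Ideal.Quotient.mk P) Ideal.Quotient.mk_surjective
  obtain ⟨q, rfl⟩ := hmap q'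
  have hgk : g.map (Ideal.Quotient.mk P) ∈ RingHom.ker θ := by
    rw [← hker, hgx]; exact p.zero_mem
  rw [hq', Ideal.mem_span_singleton] at hgk
  obtain ⟨u', hu'⟩ := hgk
  obtain ⟨u, rfl⟩ := hmap u'
  have hqp : q.eval₂ φ x ∈ p := by
    rw [hker, hq']; exact Ideal.mem_span_singleton_self _
  have hhp : φ h ∈ p := by
    change h ∈ P
    rw [hh]; exact Ideal.mem_span_singleton_self _
  -- `g' ≡ q' u + q u'` and `q(x) ∈ p`, so `u(x) ∈ p` would force `g'(x) ∈ p`. Hence `u(x)` is the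
  -- denominator wanted: `u(x) q(x)` is divisible by `h`.
  have hup : u.eval₂ φ x ∉ p := by
    intro hup
    apply hd
    rw [hker, ← derivative_map, hu', derivative_mul, derivative_map, derivative_map]
    exact Ideal.add_mem _ (Ideal.mul_mem_left _ _ ((hker u).1 hup))
      (Ideal.mul_mem_right _ _ ((hker q).1 hqp))
  have hqu : q.eval₂ φ x * u.eval₂ φ x ∈ Ideal.span {φ h} := by
    have := hzero (q * u - g) (by rw [Polynomial.map_sub, Polynomial.map_mul, hu', sub_self])
    rwa [eval₂_sub, eval₂_mul, hgx, sub_zero] at this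
  refine ⟨φ h, hhp, fun z hz => ⟨_, hup, ?_⟩⟩
  obtain ⟨f, rfl⟩ := hsurj z
  have hf := (hker f).1 hz
  rw [hq', Ideal.mem_span_singleton] at hf
  obtain ⟨w', hw'⟩ := hf
  obtain ⟨w, rfl⟩ := hmap w'
  have := hzero (f - q * w) (by rw [Polynomial.map_sub, Polynomial.map_mul, hw', sub_self])
  rw [eval₂_sub, eval₂_mul] at this
  have e : u.eval₂ φ x * eval₂RingHom φ x f = u.eval₂ φ x * (f.eval₂ φ x - q.eval₂ φ x * w.eval₂ φ x)
    + (q.eval₂ φ x * u.eval₂ φ x) * w.eval₂ φ x := by rw [coe_eval₂RingHom]; ring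
  rw [e]
  exact Ideal.add_mem _ (Ideal.mul_mem_left _ _ this) (Ideal.mul_mem_right _ _ hqu)

/-- The hypothesis makes the maximal ideal principal in each localization at a nonzero prime, and a
Noetherian local domain of this kind, not a field, is a discrete valuation ring. -/
theorem isDedekindDomain_of_exists_generator {R : Type*} [CommRing R] [IsDomain R]
    [IsNoetherianRing R]
    (H : ∀ p : Ideal R, p.IsPrime → p ≠ ⊥ →
      ∃ h ∈ p, ∀ z ∈ p, ∃ u ∉ p, u * z ∈ Ideal.span {h}) : IsDedekindDomain R := by
  have : IsDedekindDomainDvr R :=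
    { is_dvr_at_nonzero_prime := fun p hp0 hp => by
        have hf := IsLocalization.AtPrime.not_isField R hp0 (Localization.AtPrime p)
        refine ((IsDiscreteValuationRing.TFAE (Localization.AtPrime p) hf).out 0 4).2 ?_
        obtain ⟨h, hh, H⟩ := H p hp hp0
        refine ⟨algebraMap R _ h, ?_⟩
        rw [Ideal.submodule_span_eq]
        apply le_antisymm
        · rw [← Localization.AtPrime.map_eq_maximalIdeal, Ideal.map_le_iff_le_comap]
          intro z hz
          obtain ⟨u, hu, huz⟩ := H z hz
          have hu' : IsUnit (algebraMap R (Localization.AtPrime p) u) :=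
            IsLocalization.map_units _ (⟨u, hu⟩ : p.primeCompl)
          rw [Ideal.mem_comap, ← Ideal.unit_mul_mem_iff_mem _ hu', ← map_mul,
            Ideal.mem_span_singleton]
          exact map_dvd _ (Ideal.mem_span_singleton.1 huz)
        · rw [Ideal.span_singleton_le_iff_mem, ← Localization.AtPrime.map_eq_maximalIdeal]
          exact Ideal.mem_map_of_mem _ hh }
  infer_instance

open WeierstrassCurve.Affine CoordinateRing
open scoped Polynomial.Bivariate

section Weierstrass
variable {k : Type u} [Field k] (W : WeierstrassCurve k)

/-- The coordinate function `x`. -/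
def coordX : W.toAffine.CoordinateRing := mk W.toAffine (C X)

/-- The coordinate function `y`. -/
def coordY : W.toAffine.CoordinateRing := mk W.toAffine Y

theorem polynomial_def : W.toAffine.polynomial = Y ^ 2 + C (C W.a₁ * X + C W.a₃) * Y -
    C (X ^ 3 + C W.a₂ * X ^ 2 + C W.a₄ * X + C W.a₆) := rfl

theorem coord_equation : coordY W ^ 2 + algebraMap k _ W.a₁ * coordX W * coordY W +
    algebraMap k _ W.a₃ * coordY W = coordX W ^ 3 + algebraMap k _ W.a₂ * coordX W ^ 2 +
      algebraMap k _ W.a₄ * coordX W + algebraMap k _ W.a₆ := by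
  have h := (congrArg (mk W.toAffine) (polynomial_def W)).symm.trans AdjoinRoot.mk_self
  simp only [map_add, map_sub, map_mul, map_pow] at h
  have e : ∀ c : k, algebraMap k W.toAffine.CoordinateRing c = mk W.toAffine (C (C c)) :=
    fun c => rfl
  simp only [e]
  rw [← sub_eq_zero]
  refine Eq.trans ?_ h
  unfold coordX coordY
  ring

/-- The residues of `x` and `y` form a point of the curve over the fraction field of `R / p`. An
elliptic curve is nonsingular at each of its points over any field, so one of the two partial
derivatives survives there. -/
theorem coord_nonsingular [W.IsElliptic] (p : Ideal W.toAffine.CoordinateRing) [p.IsPrime] :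
    algebraMap k _ W.a₁ * coordY W - (3 * coordX W ^ 2 + 2 * algebraMap k _ W.a₂ * coordX W +
      algebraMap k _ W.a₄) ∉ p ∨
    2 * coordY W + algebraMap k _ W.a₁ * coordX W + algebraMap k _ W.a₃ ∉ p := by
  obtain ⟨f, hf⟩ : ∃ f : W.toAffine.CoordinateRing →+*
      FractionRing (W.toAffine.CoordinateRing ⧸ p), ∀ r, f r = 0 ↔ r ∈ p :=
    ⟨(algebraMap _ _).comp (Ideal.Quotient.mk p), fun r => by
      rw [← Ideal.Quotient.eq_zero_iff_mem]
      exact map_eq_zero_iff _ (IsFractionRing.injective (W.toAffine.CoordinateRing ⧸ p) _)⟩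
  let W' : WeierstrassCurve (FractionRing (W.toAffine.CoordinateRing ⧸ p)) :=
    W.map (f.comp (algebraMap k _))
  have h₁ : W'.toAffine.a₁ = f (algebraMap k _ W.a₁) := rfl
  have h₂ : W'.toAffine.a₂ = f (algebraMap k _ W.a₂) := rfl
  have h₃ : W'.toAffine.a₃ = f (algebraMap k _ W.a₃) := rfl
  have h₄ : W'.toAffine.a₄ = f (algebraMap k _ W.a₄) := rfl
  have h₆ : W'.toAffine.a₆ = f (algebraMap k _ W.a₆) := rfl
  have heq : W'.toAffine.Equation (f (coordX W)) (f (coordY W)) := by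
    rw [WeierstrassCurve.Affine.equation_iff, h₁, h₂, h₃, h₄, h₆]
    have := congrArg f (coord_equation W)
    simpa only [map_add, map_mul, map_pow] using this
  have hn := (W'.toAffine.equation_iff_nonsingular.1 heq)
  rw [WeierstrassCurve.Affine.nonsingular_iff', h₁, h₂, h₃, h₄] at hn
  rw [← hf, ← hf]
  simpa only [map_add, map_sub, map_mul, map_pow, map_ofNat] using hn.2

/-- If the `x`-derivative is not in `p`, the ring is viewed over `k[y]`; if the `y`-derivative is
not in `p`, over `k[x]`. -/
instance [W.IsElliptic] : IsDedekindDomain W.toAffine.CoordinateRing := by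
  apply isDedekindDomain_of_exists_generator
  intro p hp hp0
  obtain h | h := coord_nonsingular W p
  · let φ : k[X] →+* W.toAffine.CoordinateRing := eval₂RingHom (algebraMap k _) (coordY W)
    have hC : ∀ c, φ (C c) = algebraMap k _ c := fun c => by simp [φ]
    have hX : φ X = coordY W := by simp [φ]
    -- The Weierstrass equation as a monic cubic in `x` over `k[y]`: the outer variable stands for
    -- `x`, the inner one for `y`.
    let g : k[X][Y] := X ^ 3 + C (C W.a₂) * X ^ 2 + C (C W.a₄ - C W.a₁ * X) * X +
      C (C W.a₆ - X ^ 2 - C W.a₃ * X)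
    refine exists_generator_of_derivative_notMem φ (g := g) (x := coordX W) ?_ ?_ ?_ hp0 ?_
    · simp only [g]; monicity!
    · simp only [g, eval₂_add, eval₂_mul, eval₂_pow, eval₂_C, eval₂_X]
      simp only [map_sub, map_mul, map_pow, hC, hX]
      linear_combination -coord_equation W
    · intro z
      obtain ⟨a, b, rfl⟩ := exists_smul_basis_eq z
      refine ⟨a.map C + b.map C * C X, ?_⟩
      have e : ∀ a : k[X], (a.map C).eval₂ φ (coordX W) = algebraMap k[X] _ a := by
        intro a
        rw [eval₂_map]
        have : φ.comp C = (algebraMap k[X] W.toAffine.CoordinateRing).comp C := by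
          ext c; rw [RingHom.comp_apply, hC]; rfl
        rw [this]
        exact (hom_eval₂ a C (algebraMap k[X] W.toAffine.CoordinateRing) X).symm.trans (by
          rw [eval₂_C_X])
      rw [coe_eval₂RingHom, eval₂_add, eval₂_mul, e, e, eval₂_C, hX, Algebra.smul_def,
        Algebra.smul_def, mul_one]
      rfl
    · intro h'
      apply h
      rw [← neg_mem_iff]
      convert h' using 1
      simp only [g, derivative_add, derivative_mul, derivative_X_pow, derivative_C, derivative_X,
        eval₂_add, eval₂_mul, eval₂_pow, eval₂_C, eval₂_X, eval₂_zero, eval₂_one]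
      simp only [map_sub, map_mul, hC, hX, map_natCast]
      push_cast
      ring
  · refine exists_generator_of_derivative_notMem (algebraMap k[X] _) (g := W.toAffine.polynomial)
      (x := coordY W) monic_polynomial ?_ ?_ hp0 ?_
    · exact AdjoinRoot.eval₂_root _
    · intro z
      obtain ⟨f, rfl⟩ := AdjoinRoot.mk_surjective z
      refine ⟨f, ?_⟩
      exact AdjoinRoot.aeval_eq f
    · intro h'
      apply h
      convert h' using 1
      refine Eq.trans ?_ (congrArg (fun f => (derivative f).eval₂ (algebraMap k[X]
        W.toAffine.CoordinateRing) (coordY W)) (polynomial_def W)).symm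
      have hC : ∀ c, algebraMap k[X] W.toAffine.CoordinateRing (C c) = algebraMap k _ c :=
        fun c => rfl
      have hX : algebraMap k[X] W.toAffine.CoordinateRing X = coordX W := rfl
      simp only [derivative_add, derivative_sub, derivative_mul, derivative_X_pow, derivative_C,
        derivative_X, eval₂_add, eval₂_sub, eval₂_mul, eval₂_pow, eval₂_C, eval₂_X, eval₂_zero,
        eval₂_one]
      simp only [map_add, map_mul, hC, hX, map_natCast]
      push_cast
      ring

end Weierstrass

end LineBundleAInf

end

/-! ### Places and primes of a Dedekind domain. -/

noncomputable section

namespace LineBundleAInf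
universe u
open IsDedekindDomain

theorem isDiscreteValuationRing_of_val_eq {K : Type*} [Field K]
    (w : Valuation K (WithZero (Multiplicative ℤ))) {t : K} (ht : w t = WithZero.exp (-1)) :
    IsDiscreteValuationRing w.valuationSubring := by
  have : w.IsNontrivial := by
    refine Valuation.IsNontrivial.mk ⟨t, ?_, ?_⟩
    · rw [ht]; exact WithZero.exp_ne_zero
    · rw [ht, Ne, WithZero.exp_eq_one]; decide
  infer_instance

section DedekindPlaces

variable {k K : Type u} [Field k] [Field K] [Algebra k K]

namespace Place

/-- A discrete valuation is determined by its ring up to scale, and the element `t` of value `exp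
(-1)` fixes the scale of `w`. -/
theorem val_eq_of_mem_iff (v : Place k K) (w : Valuation K (WithZero (Multiplicative ℤ)))
    (h : ∀ f, f ∈ v.ring ↔ w f ≤ 1) {t : K} (ht : w t = WithZero.exp (-1)) (f : K) :
    v.val f = w f := by
  have h' : ∀ f, v.val f ≤ 1 ↔ w f ≤ 1 := fun f => by rw [← h, v.mem_ring_iff]
  have hlt : ∀ f, v.val f < 1 ↔ w f < 1 := by
    intro f
    by_cases hf : f = 0
    · simp [hf]
    · have := h' f⁻¹
      rw [map_inv₀, map_inv₀, inv_le_one₀ (by simpa [zero_lt_iff] using hf),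
        inv_le_one₀ (by simpa [zero_lt_iff] using hf)] at this
      rw [← not_le, this, not_le]
  have heq : ∀ f, w f = 1 → v.val f = 1 := by
    intro f hf
    refine le_antisymm ((h' f).2 hf.le) (not_lt.1 fun h1 => ?_)
    rw [hlt, hf] at h1
    exact lt_irrefl _ h1
  obtain ⟨s, hs0, hs⟩ := v.exists_val_eq (-1)
  have ht0 : t ≠ 0 := by
    rintro rfl
    rw [map_zero] at ht
    exact WithZero.exp_ne_zero ht.symm
  have hvt : v.val t = WithZero.exp (-1) := by
    have h1 : v.val t < 1 := by
      rw [hlt, ht, ← WithZero.exp_zero, WithZero.exp_lt_exp]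
      decide
    have h2 : w s < 1 := by
      rw [← hlt, hs, ← WithZero.exp_zero, WithZero.exp_lt_exp]
      decide
    apply le_antisymm
    · rw [le_exp_iff_lt_exp_add_one]
      exact h1
    · have h3 : w s ≤ w t := by
        rw [ht, le_exp_iff_lt_exp_add_one]
        exact h2
      have h4 : w (s / t) ≤ 1 := by
        rw [map_div₀]
        exact div_le_one_of_le₀ h3 zero_le
      rw [← h', map_div₀, div_le_one₀ (by simpa [zero_lt_iff] using ht0), hs] at h4
      exact h4
  by_cases hf : f = 0
  · simp [hf]
  · have hwf : w f ≠ 0 := by simpa using hf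
    -- `f` is a unit times a power of `t`, and the two valuations agree on units and on `t`.
    have hu : w (f * t ^ (WithZero.log (w f))) = 1 := by
      rw [map_mul, map_zpow₀, ht, ← WithZero.exp_zsmul, smul_eq_mul, mul_neg_one, WithZero.exp_neg,
        WithZero.exp_log hwf, mul_inv_cancel₀ hwf]
    have hu' := heq _ hu
    rw [map_mul, map_zpow₀, hvt, ← ht, ← map_zpow₀] at hu'
    rw [map_mul] at hu
    exact mul_right_cancel₀ (b := w (t ^ WithZero.log (w f)))
      (by rw [Valuation.ne_zero_iff]; exact zpow_ne_zero _ ht0) (hu'.trans hu.symm)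

end Place

variable {R : Type u} [CommRing R] [IsDedekindDomain R] [Algebra R K] [IsFractionRing R K]

variable (R) in
/-- The place `v` is not a pole of the elements of `R`. -/
def Place.IsFinite (v : Place k K) : Prop := ∀ r : R, v.val (algebraMap R K r) ≤ 1

/-- The centre on `Spec R` of a place. -/
def Place.center (v : Place k K) (hv : v.IsFinite R) : HeightOneSpectrum R where
  asIdeal := Ideal.comap ((algebraMap R K).codRestrict v.ring.toSubring
    (fun r => v.mem_ring_iff.2 (hv r))) (IsLocalRing.maximalIdeal v.ring)
  isPrime := Ideal.comap_isPrime _ _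
  -- If the centre were zero, all nonzero elements of `R`, hence all of `Kˣ`, would have value one,
  -- although `v` takes the value `exp 1`.
  ne_bot := by
    intro h
    have h1 : ∀ r : R, r ≠ 0 → v.val (algebraMap R K r) = 1 := by
      intro r hr
      refine le_antisymm (hv r) (not_lt.1 fun h1 => hr ?_)
      rw [← Ideal.mem_bot, ← h, Ideal.mem_comap, ← IsLocalRing.residue_eq_zero_iff,
        v.residue_eq_zero_iff]
      exact h1
    obtain ⟨t, ht0, ht⟩ := v.exists_val_eq 1
    obtain ⟨r, s, hs, rfl⟩ := IsFractionRing.div_surjective (A := R) t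
    have hr : r ≠ 0 := by rintro rfl; simp at ht0
    rw [map_div₀, h1 r hr, h1 s (nonZeroDivisors.ne_zero hs), div_one, eq_comm,
      WithZero.exp_eq_one] at ht
    exact one_ne_zero ht

theorem Place.mem_center (v : Place k K) (hv : v.IsFinite R) (r : R) :
    r ∈ (v.center hv).asIdeal ↔ v.val (algebraMap R K r) < 1 := by
  change _ ∈ IsLocalRing.maximalIdeal v.ring ↔ _
  rw [← IsLocalRing.residue_eq_zero_iff, v.residue_eq_zero_iff]
  rfl

theorem Place.val_eq_one_of_notMem_center (v : Place k K) (hv : v.IsFinite R) {r : R}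
    (hr : r ∉ (v.center hv).asIdeal) : v.val (algebraMap R K r) = 1 := by
  rw [v.mem_center, not_lt] at hr
  exact le_antisymm (hv r) hr

/-- The local ring of the place is the localization of `R` at the centre: integral elements are
fractions `n / d` with `d` outside the centre, and `d` is a unit at `v`. -/
theorem Place.mem_ring_iff_center (v : Place k K) (hv : v.IsFinite R) (f : K) :
    f ∈ v.ring ↔ (v.center hv).valuation K f ≤ 1 := by
  rw [v.mem_ring_iff]
  constructor
  · intro h
    by_contra! h1
    have h2 : (v.center hv).valuation K f⁻¹ < 1 := by
      rw [map_inv₀]; exact inv_lt_one_of_one_lt₀ h1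
    obtain ⟨n, d, hnd⟩ := (v.center hv).exists_primeCompl_mul_eq_of_integer f⁻¹ h2.le
    have hn : n ∈ (v.center hv).asIdeal := by
      rw [← HeightOneSpectrum.valuation_lt_one_iff_mem (K := K)]
      change (v.center hv).valuation K (algebraMap R K n) < 1
      rw [← hnd, map_mul]
      exact mul_lt_one_of_nonneg_of_lt_one_left zero_le h2 (HeightOneSpectrum.valuation_le_one _ _)
    rw [v.mem_center, ← hnd, map_mul, v.val_eq_one_of_notMem_center hv d.2, mul_one, map_inv₀] at hn
    have hf0 : 0 < v.val f := by
      rw [zero_lt_iff, Ne, map_eq_zero]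
      rintro rfl
      simp at h1
    exact absurd h (not_le.2 ((inv_lt_one₀ hf0).1 hn))
  · intro h
    obtain ⟨n, d, hnd⟩ := (v.center hv).exists_primeCompl_mul_eq_of_integer f h
    have := hv n
    rwa [← hnd, map_mul, v.val_eq_one_of_notMem_center hv d.2, mul_one] at this

theorem Place.eq_of_center_eq {v w : Place k K} (hv : v.IsFinite R) (hw : w.IsFinite R)
    (h : (v.center hv).asIdeal = (w.center hw).asIdeal) : v = w := by
  apply Place.ext_ring
  ext f
  rw [v.mem_ring_iff_center hv, w.mem_ring_iff_center hw, HeightOneSpectrum.ext h]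

/-- The place of a maximal ideal. -/
def Place.ofPrime [Algebra k R] [IsScalarTower k R K] (p : HeightOneSpectrum R) : Place k K where
  ring := (p.valuation K).valuationSubring
  const_mem c := by
    rw [IsScalarTower.algebraMap_apply k R K]
    exact p.valuation_le_one _
  isDVR := isDiscreteValuationRing_of_val_eq _ (p.valuation_exists_uniformizer K).choose_spec

theorem mem_range_of_forall_finite [Algebra k R] [IsScalarTower k R K] {f : K}
    (h : ∀ v : Place k K, v.IsFinite R → v.val f ≤ 1) : f ∈ (algebraMap R K).range := by
  refine HeightOneSpectrum.mem_integers_of_valuation_le_one K f fun p => ?_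
  have hp : ∀ g : K, (Place.ofPrime p : Place k K).val g ≤ 1 ↔ p.valuation K g ≤ 1 :=
    fun g => (Place.mem_ring_iff _).symm
  rw [← hp]
  exact h _ fun r => (hp _).2 (p.valuation_le_one r)

/-- Partial fractions: the polar part of `a` at `v` is realised by a function regular at all other
finite places. -/
theorem exists_approx (v : Place k K) (hv : v.IsFinite R) (a : K) :
    ∃ f : K, v.val (f - a) ≤ 1 ∧ ∀ w : Place k K, w.IsFinite R → w ≠ v → w.val f ≤ 1 := by
  obtain ⟨r, s, hs, rfl⟩ := IsFractionRing.div_surjective (A := R) a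
  have hs0 : s ≠ 0 := nonZeroDivisors.ne_zero hs
  set p := (v.center hv).asIdeal with hp
  have hpm : p.IsMaximal := (v.center hv).isMaximal
  -- With `a = r / s`, write `(s) = pⁿ I` and `1 = j + i` with `j ∈ pⁿ`, `i ∈ I`. The function is `i
  -- a`; it differs from `a` by `-j a`.
  obtain ⟨I, hI, hJ⟩ := Ideal.eq_prime_pow_mul_coprime
    (by simpa using hs0 : Ideal.span {s} ≠ ⊥) p
  set n := Multiset.count p (UniqueFactorizationMonoid.normalizedFactors (Ideal.span {s}))
  have hmem : ∀ i ∈ I, ∀ j ∈ p ^ n, ∃ t, j * i = s * t := by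
    intro i hi j hj
    have := Ideal.mul_mem_mul hj hi
    rw [← hJ, Ideal.mem_span_singleton] at this
    exact this
  have hval : ∀ w : Place k K, w.IsFinite R → ∀ i j t : R, j * i = s * t →
      w.val (algebraMap R K i) = 1 → w.val (algebraMap R K j * (algebraMap R K r / algebraMap R K s))
        ≤ 1 := by
    intro w hw i j t h hi
    have hs' : algebraMap R K s ≠ 0 := by simpa using hs0
    have e : algebraMap R K j * (algebraMap R K r / algebraMap R K s) * algebraMap R K i =
        algebraMap R K (r * t) := by
      have := congrArg (algebraMap R K) h
      simp only [map_mul] at this ⊢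
      field_simp
      linear_combination algebraMap R K r * this
    have h1 := hw (r * t)
    rwa [← e, map_mul, hi, mul_one] at h1
  have hcop : p ^ n ⊔ I = ⊤ := Ideal.pow_sup_eq_top hI
  obtain ⟨j, hj, i, hi, hij⟩ := Submodule.mem_sup.1 (hcop ▸ Submodule.mem_top : (1 : R) ∈ p ^ n ⊔ I)
  refine ⟨algebraMap R K i * (algebraMap R K r / algebraMap R K s), ?_, fun w hw hwv => ?_⟩
  · have e : algebraMap R K i * (algebraMap R K r / algebraMap R K s) -
        algebraMap R K r / algebraMap R K s =
        -(algebraMap R K j * (algebraMap R K r / algebraMap R K s)) := by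
      have := congrArg (algebraMap R K) hij
      rw [map_add, map_one] at this
      linear_combination (algebraMap R K r / algebraMap R K s) * this
    rw [e, Valuation.map_neg]
    -- `i'` is an element of `I` outside `p`. As `j i'` is a multiple of `s`, the denominator of `j
    -- a` can be taken to be `i'`, a unit at `v`.
    obtain ⟨j', hj', i', hi', hij'⟩ := Submodule.mem_sup.1 (hI ▸ Submodule.mem_top : (1 : R) ∈ p ⊔ I)
    have hi'p : i' ∉ p := fun h => hpm.ne_top ((Ideal.eq_top_iff_one _).2 (hij' ▸ p.add_mem hj' h))
    obtain ⟨t, ht⟩ := hmem i' hi' j hj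
    exact hval v hv i' j t ht (v.val_eq_one_of_notMem_center hv hi'p)
  · have hne : ¬ p ≤ (w.center hw).asIdeal := fun h =>
      hwv (Place.eq_of_center_eq hv hw (hpm.eq_of_le (w.center hw).isPrime.ne_top h)).symm
    -- Likewise `qⁿ i` is a multiple of `s`, so `i a` has denominator `qⁿ`, a unit at `w`.
    obtain ⟨q, hq, hqw⟩ := Set.not_subset.1 hne
    obtain ⟨t, ht⟩ := hmem i hi (q ^ n) (Ideal.pow_mem_pow hq n)
    refine hval w hw (q ^ n) i t (by rw [mul_comm, ht]) ?_
    rw [map_pow, map_pow, w.val_eq_one_of_notMem_center hw hqw, one_pow]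

/-- Vanishing of `H¹` on the affine curve; the finitely many poles are removed one at a time. -/
theorem exists_approx_rep (α : Rep k K) : ∃ f : K, ∀ v : Place k K, v.IsFinite R →
    v.val (α.1 v - f) ≤ 1 := by
  classical
  have main : ∀ (s : Finset (Place k K)) (α : Place k K → K),
      (∀ v : Place k K, v.IsFinite R → v ∉ s → v.val (α v) ≤ 1) →
      ∃ f : K, ∀ v : Place k K, v.IsFinite R → v.val (α v - f) ≤ 1 := by
    intro s
    induction s using Finset.induction_on with
    | empty => exact fun α h => ⟨0, fun v hv => by simpa using h v hv⟩
    | insert v s hvs ih =>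
      intro α h
      by_cases hv : v.IsFinite R
      · obtain ⟨f, hf, hf'⟩ := exists_approx v hv (α v)
        obtain ⟨g, hg⟩ := ih (fun w => α w - f) (fun w hw hws => by
          by_cases hwv : w = v
          · subst hwv
            rw [← Valuation.map_neg, neg_sub]
            exact hf
          · exact (w.val.map_sub _ _).trans (max_le (h w hw (by simp [hwv, hws])) (hf' w hw hwv)))
        exact ⟨f + g, fun w hw => by rw [← sub_sub]; exact hg w hw⟩
      · exact ih α fun w hw hws => h w hw (by
          simp only [Finset.mem_insert, not_or]
          exact ⟨fun h => hv (h ▸ hw), hws⟩)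
  refine main (Set.Finite.toFinset α.2) α.1 fun v _ hv => ?_
  simpa using hv

/-- The residue field is a quotient of `R`, hence a field of finite type over `k`, and the
Nullstellensatz applies. -/
theorem finite_residueField [Algebra k R] [IsScalarTower k R K] [Algebra.FiniteType k R]
    (v : Place k K) (hv : v.IsFinite R) :
    Module.Finite k (IsLocalRing.ResidueField v.ring) := by
  let g : R →ₐ[k] v.ring :=
    { (algebraMap R K).codRestrict v.ring.toSubring (fun r => v.mem_ring_iff.2 (hv r)) with
      commutes' := fun c => Subtype.ext (IsScalarTower.algebraMap_apply k R K c).symm }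
  have hg : ∀ r, (g r : K) = algebraMap R K r := fun _ => rfl
  let θ : R →ₐ[k] IsLocalRing.ResidueField v.ring :=
    (IsScalarTower.toAlgHom k v.ring (IsLocalRing.ResidueField v.ring)).comp g
  have hθ : Function.Surjective θ := by
    intro x
    obtain ⟨u, rfl⟩ := IsLocalRing.residue_surjective x
    obtain ⟨n, d, hnd⟩ := (v.center hv).exists_primeCompl_mul_eq_of_integer u.1
      ((v.mem_ring_iff_center hv _).1 u.2)
    obtain ⟨d', i, hi, hd⟩ := (v.center hv).isMaximal.exists_inv d.2
    refine ⟨n * d', ?_⟩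
    rw [← sub_eq_zero]
    change IsLocalRing.residue v.ring (g (n * d')) - IsLocalRing.residue v.ring u = 0
    rw [← map_sub, v.residue_eq_zero_iff]
    have e : ((g (n * d') - u : v.ring) : K) = -(u.1 * algebraMap R K i) := by
      change algebraMap R K (n * d') - u.1 = _
      have := congrArg (algebraMap R K) hd
      simp only [map_add, map_mul, map_one] at this ⊢
      rw [← hnd]
      linear_combination u.1 * this
    rw [e, Valuation.map_neg, map_mul]
    exact mul_lt_one_of_nonneg_of_lt_one_right (v.mem_ring_iff.1 u.2) zero_le
      ((v.mem_center hv i).1 hi)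
  have := Algebra.FiniteType.of_surjective θ hθ
  exact finite_of_finite_type_of_isJacobsonRing k _

end DedekindPlaces

end LineBundleAInf

end

/-! ### The valuation at infinity. -/

noncomputable section

namespace LineBundleAInf
universe u
open WeierstrassCurve.Affine CoordinateRing Polynomial
open scoped Polynomial.Bivariate

/-- `exp (c n)`, for a degree `n`. -/
def expDeg (c : ℤ) : WithBot ℕ → WithZero (Multiplicative ℤ)
  | ⊥ => 0
  | (n : ℕ) => WithZero.exp (c * n)

@[simp] theorem expDeg_bot (c : ℤ) : expDeg c ⊥ = 0 := rfl
theorem expDeg_coe (c : ℤ) (n : ℕ) : expDeg c (n : WithBot ℕ) = WithZero.exp (c * n) := rfl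

theorem expDeg_add (c : ℤ) (a b : WithBot ℕ) : expDeg c (a + b) = expDeg c a * expDeg c b := by
  induction a with
  | bot => simp
  | coe a =>
    induction b with
    | bot => simp
    | coe b =>
      rw [← WithBot.coe_add]
      change expDeg c ((a + b : ℕ) : WithBot ℕ) = expDeg c (a : WithBot ℕ) * expDeg c (b : WithBot ℕ)
      rw [expDeg_coe, expDeg_coe, expDeg_coe, ← WithZero.exp_add]
      push_cast
      rw [mul_add]

theorem expDeg_strictMono {c : ℤ} (hc : 0 < c) : StrictMono (expDeg c) := by
  intro a b h
  induction b with
  | bot => simp at h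
  | coe b =>
    induction a with
    | bot => exact WithZero.exp_pos
    | coe a =>
      refine WithZero.exp_lt_exp.2 ?_
      have : a < b := WithBot.coe_lt_coe.1 h
      gcongr

theorem two_nsmul_bot : 2 • (⊥ : WithBot ℕ) = ⊥ := by rw [two_nsmul, WithBot.bot_add]

section Weierstrass
variable {k : Type u} [Field k] (W : WeierstrassCurve k)

/-- The pole order at infinity of a function on the affine curve. -/
def normDeg (r : W.toAffine.CoordinateRing) : WithBot ℕ := (Algebra.norm k[X] r).degree

theorem normDeg_mul (r s : W.toAffine.CoordinateRing) :
    normDeg W (r * s) = normDeg W r + normDeg W s := by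
  rw [normDeg, map_mul, degree_mul, normDeg, normDeg]

/-- Pole orders at infinity are `2` for `x` and `3` for `y`. The parities of the two entries differ,
so the terms never cancel. -/
theorem normDeg_basis (p q : k[X]) :
    normDeg W (p • 1 + q • coordY W) = max (2 • p.degree) (2 • q.degree + 3) :=
  degree_norm_smul_basis p q

theorem exists_basis (r : W.toAffine.CoordinateRing) : ∃ p q : k[X], r = p • 1 + q • coordY W := by
  obtain ⟨p, q, h⟩ := exists_smul_basis_eq r
  exact ⟨p, q, h.symm⟩

theorem normDeg_add_le (r s : W.toAffine.CoordinateRing) :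
    normDeg W (r + s) ≤ max (normDeg W r) (normDeg W s) := by
  obtain ⟨p, q, rfl⟩ := exists_basis W r
  obtain ⟨p', q', rfl⟩ := exists_basis W s
  have e : p • (1 : W.toAffine.CoordinateRing) + q • coordY W + (p' • 1 + q' • coordY W) =
    (p + p') • 1 + (q + q') • coordY W := by
    rw [add_smul, add_smul]; abel
  have h2 : Monotone fun a : WithBot ℕ => 2 • a := fun a b h => nsmul_le_nsmul_right h 2
  have h3 : Monotone fun a : WithBot ℕ => 2 • a + 3 := fun a b h => by
    dsimp only
    gcongr
  rw [e, normDeg_basis, normDeg_basis, normDeg_basis]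
  refine max_le ?_ ?_
  · exact (h2 (degree_add_le p p')).trans (h2.map_max.trans_le
      (max_le_max (le_max_left _ _) (le_max_left _ _)))
  · exact (h3 (degree_add_le q q')).trans (h3.map_max.trans_le
      (max_le_max (le_max_right _ _) (le_max_right _ _)))

theorem normDeg_const {c : k} (hc : c ≠ 0) : normDeg W (algebraMap k _ c) = 0 := by
  have := normDeg_basis W (C c) 0
  rw [zero_smul, add_zero, degree_C hc, degree_zero, two_nsmul_bot, Algebra.smul_def,
    mul_one] at this
  exact this

theorem normDeg_eq_bot_iff {r : W.toAffine.CoordinateRing} : normDeg W r = ⊥ ↔ r = 0 := by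
  have : Module.Finite k[X] W.toAffine.CoordinateRing := .of_basis (CoordinateRing.basis W.toAffine)
  rw [normDeg, degree_eq_bot, Algebra.norm_eq_zero_iff]

/-- The pole order at infinity, as a valuation. -/
def degVal : Valuation W.toAffine.CoordinateRing (WithZero (Multiplicative ℤ)) where
  toFun r := expDeg 1 (normDeg W r)
  map_zero' := by rw [(normDeg_eq_bot_iff W).2 rfl, expDeg_bot]
  map_one' := by
    have := normDeg_const W (one_ne_zero (α := k))
    rw [map_one] at this
    rw [this]
    rfl
  map_mul' r s := by rw [normDeg_mul, expDeg_add]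
  map_add_le_max' r s := by
    rw [← (expDeg_strictMono one_pos).monotone.map_max]
    exact (expDeg_strictMono one_pos).monotone (normDeg_add_le W r s)

/-- The pole order at infinity on the function field. -/
def inftyVal : Valuation W.toAffine.FunctionField (WithZero (Multiplicative ℤ)) :=
  (degVal W).extendToLocalization (S := nonZeroDivisors _) (by
    intro r hr
    rw [Ideal.mem_primeCompl_iff, Valuation.mem_supp_iff]
    intro h
    have h' : expDeg 1 (normDeg W r) = 0 := h
    rw [← expDeg_bot 1, (expDeg_strictMono one_pos).injective.eq_iff, normDeg_eq_bot_iff] at h'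
    exact nonZeroDivisors.ne_zero hr h') _

theorem inftyVal_algebraMap (r : W.toAffine.CoordinateRing) :
    inftyVal W (algebraMap _ _ r) = expDeg 1 (normDeg W r) :=
  Valuation.extendToLocalization_apply_map_apply _ _ _ r

theorem normDeg_coordX_pow (n : ℕ) : normDeg W (coordX W ^ n) = (2 * n : ℕ) := by
  have := normDeg_basis W (X ^ n) 0
  rw [zero_smul, add_zero, degree_X_pow, degree_zero, two_nsmul_bot] at this
  rw [Algebra.smul_def, mul_one, map_pow] at this
  refine Eq.trans this ?_
  simp

theorem normDeg_coordY : normDeg W (coordY W) = 3 := by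
  have := normDeg_basis W 0 1
  rw [zero_smul, zero_add, one_smul, degree_one, degree_zero, two_nsmul_bot] at this
  simpa using this

theorem inftyVal_uniformizer : inftyVal W (algebraMap _ _ (coordX W) / algebraMap _ _ (coordY W)) =
    WithZero.exp (-1) := by
  rw [map_div₀, inftyVal_algebraMap, inftyVal_algebraMap, normDeg_coordY, ← pow_one (coordX W),
    normDeg_coordX_pow, expDeg_coe]
  change _ / WithZero.exp (1 * ((3 : ℕ) : ℤ)) = _
  rw [← WithZero.exp_sub]
  rfl

/-- The place at infinity. -/
def inftyPlace : Place k W.toAffine.FunctionField where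
  ring := (inftyVal W).valuationSubring
  const_mem c := by
    rw [Valuation.mem_valuationSubring_iff,
      IsScalarTower.algebraMap_apply k W.toAffine.CoordinateRing, inftyVal_algebraMap]
    by_cases hc : c = 0
    · rw [hc, map_zero, (normDeg_eq_bot_iff W).2 rfl]
      exact zero_le
    · rw [normDeg_const W hc]
      exact le_of_eq rfl
  isDVR := isDiscreteValuationRing_of_val_eq _ (inftyVal_uniformizer W)

theorem inftyPlace_val (f : W.toAffine.FunctionField) : (inftyPlace W).val f = inftyVal W f :=
  Place.val_eq_of_mem_iff _ _ (fun _ => Iff.rfl) (inftyVal_uniformizer W) f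

end Weierstrass

end LineBundleAInf

end

/-! ### All places of the curve, and its Euler characteristics. -/

noncomputable section

namespace LineBundleAInf
universe u
open WeierstrassCurve.Affine CoordinateRing Polynomial
open scoped Polynomial.Bivariate

section Weierstrass
variable {k : Type u} [Field k] (W : WeierstrassCurve k)

/-- A polynomial in the coordinate `x`, as a rational function on the curve. -/
def polyX : k[X] →+* W.toAffine.FunctionField :=
  (algebraMap W.toAffine.CoordinateRing _).comp (algebraMap k[X] _)

theorem polyX_C (c : k) : polyX W (C c) = algebraMap k _ c :=
  (IsScalarTower.algebraMap_apply k W.toAffine.CoordinateRing _ c).symm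

theorem polyX_X : polyX W X = algebraMap _ _ (coordX W) := rfl

theorem algebraMap_basis (p q : k[X]) :
    algebraMap W.toAffine.CoordinateRing W.toAffine.FunctionField (p • 1 + q • coordY W) =
      polyX W p + polyX W q * algebraMap _ _ (coordY W) := by
  rw [Algebra.smul_def, mul_one, Algebra.smul_def, map_add, map_mul]
  rfl

/-- The factored form `y (y + L) = cubic` lets a valuation be read off from its factors; the
coefficient `C 1` matches the shape of `degree_cubic`. -/
theorem coordY_mul_eq :
    algebraMap W.toAffine.CoordinateRing W.toAffine.FunctionField (coordY W) *
      (algebraMap _ _ (coordY W) + polyX W (C W.a₁ * X + C W.a₃)) =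
      polyX W (C 1 * X ^ 3 + C W.a₂ * X ^ 2 + C W.a₄ * X + C W.a₆) := by
  have h := congrArg (algebraMap W.toAffine.CoordinateRing W.toAffine.FunctionField)
    (coord_equation W)
  simp only [map_add, map_mul, map_pow, polyX_C, polyX_X, map_one, one_mul] at h ⊢
  simp only [← IsScalarTower.algebraMap_apply k W.toAffine.CoordinateRing
    W.toAffine.FunctionField] at h
  linear_combination h

variable (v : Place k W.toAffine.FunctionField)

theorem val_polyX_le_one (hx : v.val (polyX W X) ≤ 1) (p : k[X]) : v.val (polyX W p) ≤ 1 := by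
  induction p using Polynomial.induction_on' with
  | add p q hp hq => rw [map_add]; exact (v.val.map_add _ _).trans (max_le hp hq)
  | monomial n c =>
    rw [← C_mul_X_pow_eq_monomial, map_mul, map_pow, map_mul, map_pow, polyX_C]
    exact mul_le_one' (v.val_const_le c) (pow_le_one' hx n)

theorem val_polyX {a : ℤ} (ha : 0 < a) (hx : v.val (polyX W X) = WithZero.exp a) (p : k[X]) :
    v.val (polyX W p) = expDeg a p.degree := by
  induction hn : p.natDegree using Nat.strong_induction_on generalizing p with
  | _ n ih =>
  by_cases hp : p = 0
  · simp [hp]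
  have hlead : v.val (polyX W (C p.leadingCoeff * X ^ p.natDegree)) = expDeg a p.degree := by
    rw [map_mul, map_pow, map_mul, map_pow, polyX_C, v.val_const (leadingCoeff_ne_zero.2 hp), hx,
      one_mul, degree_eq_natDegree hp, expDeg_coe, ← WithZero.exp_nsmul, nsmul_eq_mul, mul_comm]
  have hlt : v.val (polyX W p.eraseLead) < expDeg a p.degree := by
    by_cases h0 : p.eraseLead = 0
    · rw [h0, map_zero, map_zero, ← expDeg_bot a]
      exact expDeg_strictMono ha (bot_lt_iff_ne_bot.2 (degree_ne_bot.2 hp))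
    · rw [ih _ ?_ _ rfl]
      · exact expDeg_strictMono ha (degree_eraseLead_lt hp)
      · rw [← hn]
        exact natDegree_lt_natDegree h0 (degree_eraseLead_lt hp)
  rw [← hlead] at hlt
  conv_lhs => rw [← eraseLead_add_C_mul_X_pow p]
  rw [map_add, Valuation.map_add_eq_of_lt_right _ hlt, hlead]

/-- `y` is integral over `k[x]`: a pole of `y` would give `y (y + L)` a pole, whereas the cubic in
`x` has none. -/
theorem Place.isFinite_of_val_le (hx : v.val (polyX W X) ≤ 1) :
    v.IsFinite W.toAffine.CoordinateRing := by
  have hy : v.val (algebraMap _ _ (coordY W)) ≤ 1 := by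
    by_contra! h
    have h1 := congrArg v.val (coordY_mul_eq W)
    have h2 := val_polyX_le_one W v hx (C 1 * X ^ 3 + C W.a₂ * X ^ 2 + C W.a₄ * X + C W.a₆)
    rw [← h1, map_mul, Valuation.map_add_eq_of_lt_left _
      ((val_polyX_le_one W v hx _).trans_lt h)] at h2
    exact absurd h2 (not_le.2 (one_lt_mul_of_lt_of_le' h h.le))
  intro r
  obtain ⟨p, q, rfl⟩ := exists_basis W r
  rw [algebraMap_basis]
  refine (v.val.map_add _ _).trans (max_le (val_polyX_le_one W v hx p) ?_)
  rw [map_mul]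
  exact mul_le_one' (val_polyX_le_one W v hx q) hy

/-- At a pole of `x` the equation forces the pole orders of `x` and `y` into the ratio `2 : 3`, and
parity prevents cancellation in `p(x) + q(x) y`. So `v` is a positive multiple of the pole order at
infinity on the coordinate ring. -/
theorem exists_val_eq_expDeg (hx : 1 < v.val (polyX W X)) : ∃ c : ℤ, 0 < c ∧
    ∀ r, v.val (algebraMap _ _ r) = expDeg c (normDeg W r) := by
  obtain ⟨a, ha⟩ : ∃ a : ℤ, v.val (polyX W X) = WithZero.exp a :=
    ⟨_, (WithZero.exp_log (zero_lt_one.trans hx).ne').symm⟩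
  have ha0 : 0 < a := by
    rwa [ha, ← WithZero.exp_zero, WithZero.exp_lt_exp] at hx
  have hcub := congrArg v.val (coordY_mul_eq W)
  rw [val_polyX W v ha0 ha, degree_cubic one_ne_zero, map_mul] at hcub
  have hcub' : expDeg a 3 = WithZero.exp (a * 3) := rfl
  rw [hcub'] at hcub
  have hL : v.val (polyX W (C W.a₁ * X + C W.a₃)) ≤ WithZero.exp a := by
    rw [val_polyX W v ha0 ha]
    refine ((expDeg_strictMono ha0).monotone (degree_linear_le)).trans (le_of_eq ?_)
    change WithZero.exp (a * 1) = _
    rw [mul_one]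
  have hy0 : v.val (algebraMap _ W.toAffine.FunctionField (coordY W)) ≠ 0 := by
    intro h
    rw [h, zero_mul] at hcub
    exact WithZero.exp_ne_zero hcub.symm
  obtain ⟨b, hb⟩ : ∃ b : ℤ, v.val (algebraMap _ W.toAffine.FunctionField (coordY W)) =
    WithZero.exp b := ⟨_, (WithZero.exp_log hy0).symm⟩
  rw [hb] at hcub
  -- If `b ≤ a`, the product `y (y + L)` would have value at most `exp (2 a)`, less than the value
  -- `exp (3 a)` of the cubic.
  have hab : a < b := by
    by_contra! h
    have h1 := (v.val.map_add (algebraMap _ W.toAffine.FunctionField (coordY W))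
      (polyX W (C W.a₁ * X + C W.a₃))).trans (max_le (hb.trans_le (WithZero.exp_le_exp.2 h)) hL)
    have h2 := mul_le_mul' (WithZero.exp_le_exp.2 h) h1
    rw [hcub, ← WithZero.exp_add, WithZero.exp_le_exp] at h2
    omega
  rw [Valuation.map_add_eq_of_lt_left _ (hL.trans_lt (by rwa [hb, WithZero.exp_lt_exp])), hb,
    ← WithZero.exp_add, WithZero.exp_inj] at hcub
  -- Now `y` dominates `y + L`, so `2 b = 3 a`.
  obtain ⟨c, rfl⟩ : ∃ c, a = 2 * c := ⟨b - a, by omega⟩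
  obtain rfl : b = 3 * c := by omega
  refine ⟨c, by omega, fun r => ?_⟩
  have h2 : ∀ d : WithBot ℕ, expDeg (2 * c) d = expDeg c (2 • d) := by
    intro d
    induction d with
    | bot => rw [two_nsmul_bot]; rfl
    | coe d =>
      have e : 2 • (d : WithBot ℕ) = ((2 * d : ℕ) : WithBot ℕ) := by push_cast; simp
      change expDeg (2 * c) (d : WithBot ℕ) = expDeg c (2 • (d : WithBot ℕ))
      rw [e, expDeg_coe, expDeg_coe]
      congr 1
      push_cast
      ring
  have h3 : WithZero.exp (3 * c) = expDeg c 3 := by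
    change _ = WithZero.exp (c * 3)
    rw [mul_comm]
  obtain ⟨p, q, rfl⟩ := exists_basis W r
  have hp := val_polyX W v ha0 ha p
  have hq : v.val (polyX W q * algebraMap _ _ (coordY W)) = expDeg c (2 • q.degree + 3) := by
    rw [map_mul, val_polyX W v ha0 ha q, hb, h2, h3, expDeg_add]
  rw [h2] at hp
  have hc : 0 < c := by omega
  rw [algebraMap_basis, normDeg_basis, (expDeg_strictMono hc).monotone.map_max, ← hp, ← hq]
  by_cases h0 : p = 0 ∧ q = 0
  · simp [h0.1, h0.2]
  refine Valuation.map_add_of_distinct_val _ ?_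
  rw [hp, hq, (expDeg_strictMono hc).injective.ne_iff]
  intro h
  by_cases hp0 : p = 0
  · rw [hp0, degree_zero, two_nsmul_bot] at h
    have hq0 : q ≠ 0 := fun hq0 => h0 ⟨hp0, hq0⟩
    rw [degree_eq_natDegree hq0, two_nsmul] at h
    exact (WithBot.natCast_ne_bot (q.natDegree + q.natDegree + 3)) (by rw [h]; push_cast; rfl)
  by_cases hq0 : q = 0
  · rw [hq0, degree_zero, two_nsmul_bot, degree_eq_natDegree hp0, two_nsmul, WithBot.bot_add] at h
    exact (WithBot.natCast_ne_bot (p.natDegree + p.natDegree)) (by rw [← h]; push_cast; rfl)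
  rw [degree_eq_natDegree hp0, degree_eq_natDegree hq0, two_nsmul, two_nsmul] at h
  have h' : p.natDegree + p.natDegree = q.natDegree + q.natDegree + 3 := by exact_mod_cast h
  omega

theorem Place.eq_inftyPlace (hx : 1 < v.val (polyX W X)) : v = inftyPlace W := by
  obtain ⟨c, hc, h⟩ := exists_val_eq_expDeg W v hx
  apply Place.ext_ring
  ext f
  rw [Place.mem_ring_iff, Place.mem_ring_iff, inftyPlace_val]
  obtain ⟨r, s, hs, rfl⟩ := IsFractionRing.div_surjective (A := W.toAffine.CoordinateRing) f
  have hs0 : algebraMap _ W.toAffine.FunctionField s ≠ 0 := by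
    simpa using nonZeroDivisors.ne_zero hs
  have hpos : ∀ w : Valuation W.toAffine.FunctionField (WithZero (Multiplicative ℤ)),
      0 < w (algebraMap _ _ s) := fun w => by simpa [zero_lt_iff] using hs0
  rw [map_div₀, map_div₀, div_le_one₀ (hpos _), div_le_one₀ (hpos _), h, h, inftyVal_algebraMap,
    inftyVal_algebraMap, (expDeg_strictMono hc).le_iff_le, (expDeg_strictMono one_pos).le_iff_le]

theorem Place.finite_or_eq_infty : v.IsFinite W.toAffine.CoordinateRing ∨ v = inftyPlace W := by
  by_cases h : v.val (polyX W X) ≤ 1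
  · exact .inl (Place.isFinite_of_val_le W v h)
  · exact .inr (Place.eq_inftyPlace W v (not_le.1 h))

theorem not_isFinite_inftyPlace : ¬ (inftyPlace W).IsFinite W.toAffine.CoordinateRing := by
  intro h
  have h1 := h (coordX W)
  rw [inftyPlace_val, inftyVal_algebraMap, ← pow_one (coordX W), normDeg_coordX_pow, expDeg_coe,
    ← WithZero.exp_zero, WithZero.exp_le_exp] at h1
  simp at h1

theorem normDeg_lt_iff (p q : k[X]) (M : ℕ) : normDeg W (p • 1 + q • coordY W) < M ↔
    (∀ i, M ≤ 2 * i → p.coeff i = 0) ∧ ∀ i, M ≤ 2 * i + 3 → q.coeff i = 0 := by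
  have main : ∀ (p : k[X]) (b : ℕ), 2 • p.degree + (b : WithBot ℕ) < M ↔
      ∀ i, M ≤ 2 * i + b → p.coeff i = 0 := by
    intro p b
    by_cases hp : p = 0
    · simp only [hp, degree_zero, two_nsmul_bot, WithBot.bot_add, coeff_zero, implies_true, iff_true]
      exact WithBot.bot_lt_coe M
    · have e : 2 • p.degree + (b : WithBot ℕ) = ((2 * p.natDegree + b : ℕ) : WithBot ℕ) := by
        rw [degree_eq_natDegree hp]; push_cast; simp
      rw [e, Nat.cast_lt]
      constructor
      · intro h i hi
        exact coeff_eq_zero_of_natDegree_lt (by omega)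
      · intro h
        by_contra! h'
        exact hp (leadingCoeff_eq_zero.1 (h _ h'))
  have h0 := main p 0
  rw [Nat.cast_zero, add_zero] at h0
  rw [normDeg_basis, max_lt_iff]
  exact and_congr h0 (main q 3)

/-- Functions on the affine curve of the same pole order at infinity are proportional up to
functions of smaller pole order. -/
theorem exists_normDeg_sub_lt {r s : W.toAffine.CoordinateRing} (hs : s ≠ 0)
    (h : normDeg W r ≤ normDeg W s) : ∃ c : k, normDeg W (r - algebraMap k _ c * s) < normDeg W s := by
  obtain ⟨M, hM⟩ := WithBot.ne_bot_iff_exists.1 ((normDeg_eq_bot_iff W).not.2 hs)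
  have hM' : normDeg W s = (M : WithBot ℕ) := hM.symm
  have hs1 : ¬ normDeg W s < (M : WithBot ℕ) := by rw [hM']; exact lt_irrefl _
  have hs2 : normDeg W s < ((M + 1 : ℕ) : WithBot ℕ) := by
    rw [hM', Nat.cast_lt]; exact Nat.lt_succ_self M
  have hr2 := h.trans_lt hs2
  rw [hM']
  obtain ⟨p, q, rfl⟩ := exists_basis W r
  obtain ⟨p', q', rfl⟩ := exists_basis W s
  have hsub : ∀ c : k, p • (1 : W.toAffine.CoordinateRing) + q • coordY W -
      algebraMap k _ c * (p' • 1 + q' • coordY W) = (p - C c * p') • 1 + (q - C c * q') • coordY W := by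
    intro c
    have e : algebraMap k W.toAffine.CoordinateRing c = algebraMap k[X] _ (C c) := rfl
    rw [e]
    simp only [Algebra.smul_def, map_sub, map_mul]
    ring
  rw [normDeg_lt_iff] at hs1 hs2 hr2
  simp only [hsub, normDeg_lt_iff, coeff_sub, coeff_C_mul]
  rw [not_and_or] at hs1
  push Not at hs1
  obtain ⟨i, hi, hi0⟩ | ⟨i, hi, hi0⟩ := hs1
  -- The pole order `M` of `s` is attained by a single monomial `xⁱ` or `xⁱ y`; the constant is the
  -- quotient of the coefficients of that monomial.
  · have hi' : M = 2 * i := by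
      by_contra hne
      exact hi0 (hs2.1 i (by omega))
    refine ⟨p.coeff i / p'.coeff i, fun j hj => ?_, fun j hj => ?_⟩
    · by_cases hij : j = i
      · rw [hij, div_mul_cancel₀ _ hi0, sub_self]
      · rw [hr2.1 j (by omega), hs2.1 j (by omega), mul_zero, sub_zero]
    · rw [hr2.2 j (by omega), hs2.2 j (by omega), mul_zero, sub_zero]
  · have hi' : M = 2 * i + 3 := by
      by_contra hne
      exact hi0 (hs2.2 i (by omega))
    refine ⟨q.coeff i / q'.coeff i, fun j hj => ?_, fun j hj => ?_⟩
    · rw [hr2.1 j (by omega), hs2.1 j (by omega), mul_zero, sub_zero]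
    · by_cases hij : j = i
      · rw [hij, div_mul_cancel₀ _ hi0, sub_self]
      · rw [hr2.2 j (by omega), hs2.2 j (by omega), mul_zero, sub_zero]

theorem exists_inftyVal_sub_lt {f g : W.toAffine.FunctionField} (hg : g ≠ 0)
    (h : inftyVal W f ≤ inftyVal W g) :
    ∃ c : k, inftyVal W (f - algebraMap k _ c * g) < inftyVal W g := by
  obtain ⟨r, s, hs, rfl⟩ := IsFractionRing.div_surjective (A := W.toAffine.CoordinateRing) f
  obtain ⟨r', s', hs', rfl⟩ := IsFractionRing.div_surjective (A := W.toAffine.CoordinateRing) g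
  have hs0 : algebraMap _ W.toAffine.FunctionField s ≠ 0 := by
    simpa using nonZeroDivisors.ne_zero hs
  have hs0' : algebraMap _ W.toAffine.FunctionField s' ≠ 0 := by
    simpa using nonZeroDivisors.ne_zero hs'
  have hr' : r' * s ≠ 0 := by
    refine mul_ne_zero ?_ (nonZeroDivisors.ne_zero hs)
    rintro rfl
    simp at hg
  have hss : inftyVal W (algebraMap _ _ s * algebraMap _ _ s') ≠ 0 := by
    rw [Valuation.ne_zero_iff]
    exact mul_ne_zero hs0 hs0'
  have hss' := zero_lt_iff.2 hss
  have e1 : algebraMap _ W.toAffine.FunctionField r / algebraMap _ _ s =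
      algebraMap _ _ (r * s') / (algebraMap _ _ s * algebraMap _ _ s') := by
    rw [map_mul]; field_simp
  have e2 : algebraMap _ W.toAffine.FunctionField r' / algebraMap _ _ s' =
      algebraMap _ _ (r' * s) / (algebraMap _ _ s * algebraMap _ _ s') := by
    rw [map_mul]; field_simp
  rw [e1, e2, map_div₀, map_div₀, div_le_div_iff_of_pos_right hss', inftyVal_algebraMap,
    inftyVal_algebraMap, (expDeg_strictMono one_pos).le_iff_le] at h
  obtain ⟨c, hc⟩ := exists_normDeg_sub_lt W hr' h
  refine ⟨c, ?_⟩
  rw [e1, e2, mul_div_assoc', ← sub_div, map_div₀, map_div₀, div_lt_div_iff_of_pos_right hss',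
    IsScalarTower.algebraMap_apply k W.toAffine.CoordinateRing, ← map_mul, ← map_sub,
    inftyVal_algebraMap, inftyVal_algebraMap]
  exact expDeg_strictMono one_pos hc

/-- Every order except the gap `1` occurs; this one gap is the genus. -/
theorem exists_normDeg_eq {n : ℕ} (hn : 2 ≤ n) : ∃ r, normDeg W r = (n : WithBot ℕ) := by
  obtain ⟨i, rfl | rfl⟩ : ∃ i, n = 2 * i ∨ n = 2 * i + 3 := by
    obtain ⟨i, hi⟩ | ⟨i, hi⟩ := Nat.even_or_odd n
    · exact ⟨i, .inl (by omega)⟩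
    · exact ⟨i - 1, .inr (by omega)⟩
  · exact ⟨_, normDeg_coordX_pow W i⟩
  · refine ⟨coordX W ^ i * coordY W, ?_⟩
    rw [normDeg_mul, normDeg_coordX_pow, normDeg_coordY]
    push_cast
    rfl

/-- Poles at infinity are lowered one order at a time by functions on the affine curve, down to the
gap. -/
theorem exists_inftyVal_sub_le (f : W.toAffine.FunctionField) :
    ∃ r, inftyVal W (f - algebraMap W.toAffine.CoordinateRing _ r) ≤ WithZero.exp 1 := by
  have main : ∀ (n : ℕ) (f : W.toAffine.FunctionField), inftyVal W f ≤ WithZero.exp (n + 1 : ℤ) →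
      ∃ r, inftyVal W (f - algebraMap W.toAffine.CoordinateRing _ r) ≤ WithZero.exp 1 := by
    intro n
    induction n with
    | zero => exact fun f hf => ⟨0, by simpa using hf⟩
    | succ n ih =>
      intro f hf
      obtain ⟨r, hr⟩ := exists_normDeg_eq W (show 2 ≤ n + 2 by omega)
      have hr' : inftyVal W (algebraMap _ _ r) = WithZero.exp (((n + 1 : ℕ) : ℤ) + 1) := by
        rw [inftyVal_algebraMap, hr, expDeg_coe]
        push_cast
        ring_nf
      rw [← hr'] at hf
      obtain ⟨c, hc⟩ := exists_inftyVal_sub_lt W (by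
        intro h
        rw [h, map_zero] at hr'
        exact WithZero.exp_ne_zero hr'.symm) hf
      rw [hr', ← le_exp_iff_lt_exp_add_one] at hc
      push_cast at hc
      obtain ⟨s, hs⟩ := ih _ hc
      refine ⟨algebraMap k _ c * r + s, ?_⟩
      rwa [map_add, map_mul, ← IsScalarTower.algebraMap_apply, ← sub_sub]
  refine main (WithZero.log (inftyVal W f)).toNat f ((WithZero.le_exp_log).trans ?_)
  rw [WithZero.exp_le_exp]
  omega

/-- Among functions of pole order at most zero, subtracting a constant lowers the order, so all
residues are constants and infinity is a rational point. -/
theorem residue_inftyPlace (x : IsLocalRing.ResidueField (inftyPlace W).ring) :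
    ∃ c : k, c • (1 : IsLocalRing.ResidueField (inftyPlace W).ring) = x := by
  obtain ⟨u, rfl⟩ := IsLocalRing.residue_surjective x
  obtain ⟨c, hc⟩ := exists_inftyVal_sub_lt W (f := u.1) one_ne_zero (by
    rw [map_one]
    exact u.2)
  refine ⟨c, ?_⟩
  have h1 : c • (1 : IsLocalRing.ResidueField (inftyPlace W).ring) =
    IsLocalRing.residue _ (algebraMap k (inftyPlace W).ring c) := by
    rw [Algebra.smul_def, mul_one]; rfl
  rw [h1, eq_comm, ← sub_eq_zero, ← map_sub, Place.residue_eq_zero_iff, inftyPlace_val]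
  rwa [map_one, mul_one] at hc

theorem degree_inftyPlace : (inftyPlace W).degree = 1 :=
  finrank_eq_one 1 one_ne_zero (residue_inftyPlace W)

theorem finite_residue_inftyPlace :
    Module.Finite k (IsLocalRing.ResidueField (inftyPlace W).ring) :=
  Module.finite_of_finrank_eq_succ (degree_inftyPlace W)

variable [W.IsElliptic]

/-- A function with at most a simple pole at infinity is constant, so `h⁰ = 1`. For `h¹ = 0`, a
repartition is first approximated at the finite places, then corrected at infinity by a function
that is regular at the finite ones. -/
theorem hasEuler_infty :
    HasEuler (Finsupp.single (inftyPlace W) 1 : LineBundle k W.toAffine.FunctionField) := by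
  have hfin : ∀ v : Place k W.toAffine.FunctionField, v.IsFinite W.toAffine.CoordinateRing →
      (Finsupp.single (inftyPlace W) 1 : LineBundle k W.toAffine.FunctionField) v = 0 := by
    intro v hv
    refine Finsupp.single_eq_of_ne ?_
    rintro rfl
    exact not_isFinite_inftyPlace W hv
  have hone : (1 : W.toAffine.FunctionField) ∈
      H0 (Finsupp.single (inftyPlace W) 1 : LineBundle k W.toAffine.FunctionField) := by
    intro v
    rw [map_one, ← WithZero.exp_zero, WithZero.exp_le_exp]
    by_cases h : inftyPlace W = v
    · simp [h]
    · simp [h]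
  have h0 : Module.finrank k
      (H0 (Finsupp.single (inftyPlace W) 1 : LineBundle k W.toAffine.FunctionField)) = 1 := by
    refine finrank_eq_one (⟨1, hone⟩ : H0 _) (fun h => one_ne_zero (congrArg Subtype.val h)) ?_
    rintro ⟨f, hf⟩
    obtain ⟨r, rfl⟩ := mem_range_of_forall_finite (k := k) (R := W.toAffine.CoordinateRing) (f := f)
      (fun v hv => by simpa [hfin v hv] using hf v)
    have h1 := hf (inftyPlace W)
    rw [Finsupp.single_eq_same, inftyPlace_val, inftyVal_algebraMap] at h1
    have h2 : expDeg 1 (normDeg W r) < expDeg 1 ((2 : ℕ) : WithBot ℕ) :=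
      h1.trans_lt (by rw [expDeg_coe, WithZero.exp_lt_exp]; decide)
    rw [(expDeg_strictMono one_pos).lt_iff_lt] at h2
    obtain ⟨p, q, rfl⟩ := exists_basis W r
    rw [normDeg_lt_iff] at h2
    refine ⟨p.coeff 0, Subtype.ext ?_⟩
    have hp : p = C (p.coeff 0) := by
      ext i
      rw [coeff_C]
      split_ifs with hi
      · rw [hi]
      · exact h2.1 i (by omega)
    have hq : q = 0 := by
      ext i
      exact h2.2 i (by omega)
    change p.coeff 0 • (1 : W.toAffine.FunctionField) = algebraMap _ _ _
    rw [algebraMap_basis, hq, map_zero, zero_mul, add_zero, Algebra.smul_def, mul_one, ← polyX_C,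
      ← hp]
  have h1 : Subsingleton
      (H1 (Finsupp.single (inftyPlace W) 1 : LineBundle k W.toAffine.FunctionField)) := by
    refine subsingleton_of_forall_eq 0 fun x => ?_
    obtain ⟨α, rfl⟩ := Submodule.Quotient.mk_surjective _ x
    obtain ⟨f, hf⟩ := exists_approx_rep (R := W.toAffine.CoordinateRing) α
    obtain ⟨r, hr⟩ := exists_inftyVal_sub_le W (α.1 (inftyPlace W) - f)
    rw [mk_eq_zero_iff]
    refine ⟨f + algebraMap _ _ r, fun v => ?_⟩
    rw [← sub_sub]
    obtain hv | rfl := Place.finite_or_eq_infty W v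
    · rw [hfin v hv, WithZero.exp_zero]
      exact (v.val.map_sub _ _).trans (max_le (hf v hv) (hv r))
    · rw [Finsupp.single_eq_same, inftyPlace_val]
      exact hr
  refine ⟨Module.finite_of_finrank_eq_succ h0, inferInstance, ?_⟩
  rw [h0, Module.finrank_zero_of_subsingleton, LineBundle.degree_single, degree_inftyPlace]
  rfl

theorem genusOne : GenusOne k W.toAffine.FunctionField := by
  refine GenusOne.of_hasEuler (fun v => ?_) (hasEuler_infty W)
  obtain hv | rfl := Place.finite_or_eq_infty W v
  · have : Algebra.FiniteType k W.toAffine.CoordinateRing :=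
      Algebra.FiniteType.trans (S := k[X]) inferInstance inferInstance
    exact finite_residueField v hv
  · exact finite_residue_inftyPlace W

end Weierstrass

end LineBundleAInf

end

/-! ### Composition, the `A∞`-relations and homotopies for triple products. -/

noncomputable section

namespace LineBundleAInf
universe u
variable {k K : Type u} [Field k] [Field K] [Algebra k K]

theorem mem_homog_zero {X Y : LineBundle k K} {a : Hom X Y} : a ∈ homog X Y 0 ↔ a.2 = 0 := by
  simp [homog, Submodule.mem_prod]

theorem mem_homog_one {X Y : LineBundle k K} {a : Hom X Y} : a ∈ homog X Y 1 ↔ a.1 = 0 := by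
  simp [homog, Submodule.mem_prod]

theorem H1.cast_rfl {D : LineBundle k K} (x : H1 D) : H1.cast (rfl : D = D) x = x := by
  obtain ⟨α, rfl⟩ := Submodule.Quotient.mk_surjective _ x
  rfl

theorem H1.cast_cast {D D' D'' : LineBundle k K} (h : D = D') (h' : D' = D'') (x : H1 D) :
    H1.cast h' (H1.cast h x) = H1.cast (h.trans h') x := by
  subst h h'
  rw [H1.cast_rfl]

theorem mul01_zero {D D' : LineBundle k K} (x : H1 D') : mul01 (0 : H0 D) x = 0 := by
  obtain ⟨α, rfl⟩ := Submodule.Quotient.mk_surjective _ x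
  rw [mul01_mk, mk_eq_zero_iff]
  refine ⟨0, fun v => ?_⟩
  change v.val (0 * α.1 v - 0) ≤ _
  rw [zero_mul, sub_zero, map_zero]
  exact zero_le

theorem add_mul01 {D D' : LineBundle k K} (f g : H0 D) (x : H1 D') :
    mul01 (f + g) x = mul01 f x + mul01 g x := by
  obtain ⟨α, rfl⟩ := Submodule.Quotient.mk_surjective _ x
  rw [mul01_mk, mul01_mk, mul01_mk, ← Submodule.Quotient.mk_add]
  congr 1
  exact Subtype.ext (funext fun v => add_mul _ _ _)

theorem comp_fst {X Y Z : LineBundle k K} (a : Hom X Y) (b : Hom Y Z) :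
    ((comp a b).1 : K) = a.1 * b.1 := rfl

theorem comp_snd {X Y Z : LineBundle k K} (a : Hom X Y) (b : Hom Y Z) :
    (comp a b).2 = H1.cast (show Y - X + (Z - Y) = Z - X by abel) (mul01 a.1 b.2) +
      H1.cast (show Y - X + (Z - Y) = Z - X by abel) (mul10 a.2 b.1) := rfl

theorem mul10_eq {D D' : LineBundle k K} (x : H1 D) (g : H0 D') :
    mul10 x g = H1.cast (add_comm D' D) (mul01 g x) := rfl

theorem comp_zero {X Y Z : LineBundle k K} (a : Hom X Y) : comp a (0 : Hom Y Z) = 0 := by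
  refine Prod.ext (Subtype.ext (mul_zero _)) ?_
  rw [comp_snd, mul10_eq]
  simp [mul01_zero]

theorem zero_comp {X Y Z : LineBundle k K} (b : Hom Y Z) : comp (0 : Hom X Y) b = 0 := by
  refine Prod.ext (Subtype.ext (zero_mul _)) ?_
  rw [comp_snd, mul10_eq]
  simp [mul01_zero]

theorem comp_add {X Y Z : LineBundle k K} (a : Hom X Y) (b c : Hom Y Z) :
    comp a (b + c) = comp a b + comp a c := by
  refine Prod.ext (Subtype.ext (mul_add _ _ _)) ?_
  simp only [comp_snd, mul10_eq, Prod.snd_add, Prod.fst_add, map_add, add_mul01]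
  abel

theorem comp_neg {X Y Z : LineBundle k K} (a : Hom X Y) (b : Hom Y Z) :
    comp a (-b) = -comp a b := by
  rw [eq_neg_iff_add_eq_zero, ← comp_add, neg_add_cancel, comp_zero]

theorem of0_mem_homog {L X Y : LineBundle k K} (h : L = Y - X) (s : H0 L) :
    Hom.of0 h s ∈ homog X Y 0 := mem_homog_zero.2 rfl

theorem of1_mem_homog {L X Y : LineBundle k K} (h : L = Y - X) (e : H1 L) :
    Hom.of1 h e ∈ homog X Y 1 := mem_homog_one.2 rfl

theorem comp_mem_homog_zero {X Y Z : LineBundle k K} {a : Hom X Y} {b : Hom Y Z}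
    (ha : a ∈ homog X Y 0) (hb : b ∈ homog Y Z 0) : comp a b ∈ homog X Z 0 := by
  rw [mem_homog_zero] at *
  rw [comp_snd, mul10_eq, ha, hb]
  simp

theorem comp_mem_homog_one_right {X Y Z : LineBundle k K} {a : Hom X Y} {b : Hom Y Z}
    (hb : b ∈ homog Y Z 1) : comp a b ∈ homog X Z 1 := by
  rw [mem_homog_one] at *
  refine Subtype.ext ?_
  rw [comp_fst, hb]
  exact mul_zero _

theorem comp_mem_homog_one_left {X Y Z : LineBundle k K} {a : Hom X Y} {b : Hom Y Z}
    (ha : a ∈ homog X Y 1) : comp a b ∈ homog X Z 1 := by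
  rw [mem_homog_one] at *
  refine Subtype.ext ?_
  rw [comp_fst, ha]
  exact zero_mul _

theorem comp_of0_of0 {L L' X Y Z : LineBundle k K} (h : L = Y - X) (h' : L' = Z - Y)
    (h'' : L + L' = Z - X) (s : H0 L) (t : H0 L') :
    comp (Hom.of0 h s) (Hom.of0 h' t) = Hom.of0 h'' (mul00 s t) := by
  refine Prod.ext (Subtype.ext rfl) ?_
  exact mem_homog_zero.1 (comp_mem_homog_zero (of0_mem_homog h s) (of0_mem_homog h' t))

theorem comp_of0_of1 {L L' X Y Z : LineBundle k K} (h : L = Y - X) (h' : L' = Z - Y)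
    (h'' : L + L' = Z - X) (s : H0 L) (e : H1 L') :
    comp (Hom.of0 h s) (Hom.of1 h' e) = Hom.of1 h'' (mul01 s e) := by
  subst h h'
  refine Prod.ext (mem_homog_one.1 (comp_mem_homog_one_right (of1_mem_homog _ e))) ?_
  rw [comp_snd, mul10_eq]
  simp only [Hom.of0, Hom.of1, H1.cast_rfl, map_zero, add_zero]
  rfl

theorem comp_of1_of0 {L L' X Y Z : LineBundle k K} (h : L = Y - X) (h' : L' = Z - Y)
    (h'' : L + L' = Z - X) (e : H1 L) (s : H0 L') :
    comp (Hom.of1 h e) (Hom.of0 h' s) = Hom.of1 h'' (mul10 e s) := by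
  subst h h'
  refine Prod.ext (mem_homog_one.1 (comp_mem_homog_one_left (of1_mem_homog _ e))) ?_
  rw [comp_snd]
  simp only [Hom.of0, Hom.of1, H1.cast_rfl, map_zero, zero_add]
  rfl

section Products
variable {T : Transversality k K} {τ : RegularDifferential k K}

theorem sgn_even {V : Type*} [AddCommGroup V] {n : ℤ} (h : Even n) (x : V) : sgn n x = x := by
  rw [sgn, Int.negOnePow_even n h, one_smul]

theorem sgn_odd {V : Type*} [AddCommGroup V] {n : ℤ} (h : Odd n) (x : V) : sgn n x = -x := by
  rw [sgn, Int.negOnePow_odd n h, Units.neg_smul, one_smul]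

theorem sgn_zero {V : Type*} [AddCommGroup V] {n : ℤ} : sgn n (0 : V) = 0 := smul_zero _

/-- The composable triple `(a, b, c)`. -/
abbrev Chain.triple {X₀ X₁ X₂ X₃ : LineBundle k K} (a : Hom X₀ X₁) (b : Hom X₁ X₂)
    (c : Hom X₂ X₃) : Chain Hom X₀ X₃ := .cons a (.cons b (.single c))

theorem coll_four {X₀ X₁ X₂ X₃ : LineBundle k K} : T.Coll [X₀, X₁, X₂, X₃] ↔
    (T.rel X₀ X₁ ∧ T.rel X₀ X₂ ∧ T.rel X₀ X₃) ∧ (T.rel X₁ X₂ ∧ T.rel X₁ X₃) ∧ T.rel X₂ X₃ := by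
  simp [Transversality.Coll]

theorem coll_five {X₀ X₁ X₂ X₃ X₄ : LineBundle k K} : T.Coll [X₀, X₁, X₂, X₃, X₄] ↔
    (T.rel X₀ X₁ ∧ T.rel X₀ X₂ ∧ T.rel X₀ X₃ ∧ T.rel X₀ X₄) ∧ T.Coll [X₁, X₂, X₃, X₄] := by
  simp [Transversality.Coll]

theorem coll_six {X₀ X₁ X₂ X₃ X₄ X₅ : LineBundle k K} : T.Coll [X₀, X₁, X₂, X₃, X₄, X₅] ↔
    (T.rel X₀ X₁ ∧ T.rel X₀ X₂ ∧ T.rel X₀ X₃ ∧ T.rel X₀ X₄ ∧ T.rel X₀ X₅) ∧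
      T.Coll [X₁, X₂, X₃, X₄, X₅] := by
  simp [Transversality.Coll]

theorem IsMultilinear.map_zero {m : ∀ {X Y : LineBundle k K}, Chain Hom X Y → Hom X Y}
    (hm : IsMultilinear T m) {X Y Z W : LineBundle k K} (p : Chain Hom X Y) (q : Chain Hom Z W)
    (h : T.Coll (p.append (Chain.cons (0 : Hom Y Z) q)).objects) :
    m (p.append (Chain.cons (0 : Hom Y Z) q)) = 0 := (hm p q 0 h).map_zero

/-- The terms with `m₄` drop out because `m₁ = 0`, leaving `m₃` with a product inserted and products
with `m₃`. Taking `a` of degree zero makes the signs independent of the other degrees. -/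
theorem AInfStructure.IsAdmissible.constraint_four {A : AInfStructure T}
    (hA : A.IsAdmissible τ) {X₀ X₁ X₂ X₃ X₄ : LineBundle k K}
    (hT : T.Coll [X₀, X₁, X₂, X₃, X₄]) {a : Hom X₀ X₁} {b : Hom X₁ X₂} {c : Hom X₂ X₃}
    {d : Hom X₃ X₄} {d₂ d₃ d₄ : ℤ} (ha : a ∈ homog _ _ 0) (hb : b ∈ homog _ _ d₂)
    (hc : c ∈ homog _ _ d₃) (hd : d ∈ homog _ _ d₄) :
    -A.m (.triple (comp a b) c d) + A.m (.triple a (comp b c) d) - A.m (.triple a b (comp c d)) +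
      comp (A.m (.triple a b c)) d + comp a (A.m (.triple b c d)) = 0 := by
  have h := A.constraint (.cons a (.cons b (.cons c (.single d)))) [0, d₂, d₃, d₄] hT
    ⟨ha, hb, hc, hd, trivial⟩
  have hT' := hT
  simp only [Transversality.Coll, List.pairwise_cons, List.mem_cons, List.not_mem_nil, or_false,
    forall_eq_or_imp, forall_eq, IsEmpty.forall_iff, implies_true, List.Pairwise.nil,
    and_true] at hT'
  obtain ⟨⟨r01, r02, r03, r04⟩, ⟨r12, r13, r14⟩, ⟨r23, r24⟩, r34⟩ := hT'
  have z1 := IsMultilinear.map_zero A.multilinear (.nil X₀) (.cons b (.cons c (.single d))) hT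
  have z2 := IsMultilinear.map_zero A.multilinear (.single a) (.cons c (.single d)) hT
  have z3 := IsMultilinear.map_zero A.multilinear (.cons a (.single b)) (.single d) hT
  have z4 := IsMultilinear.map_zero A.multilinear (.cons a (.cons b (.single c))) (.nil X₄) hT
  have t1 := hA.m_two (A.m (.triple a b c)) d (by simp [Transversality.Coll, *])
  have t2 := hA.m_two a (A.m (.triple b c d)) (by simp [Transversality.Coll, *])
  have t3 := hA.m_two a b (by simp [Transversality.Coll, *])
  have t4 := hA.m_two b c (by simp [Transversality.Coll, *])
  have t5 := hA.m_two c d (by simp [Transversality.Coll, *])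
  have o1 := hA.m_one a r01
  have o2 := hA.m_one b r12
  have o3 := hA.m_one c r23
  have o4 := hA.m_one d r34
  have o5 := hA.m_one (A.m (.cons a (.cons b (.cons c (.single d))))) r04
  simp only [Chain.triple, Chain.single, Chain.append] at *
  simp [axiomSum, Chain.splits, Chain.append, Chain.length, o1, o2, o3, o4, o5, z1, z2, z3, z4, t1,
    t2, t3, t4, t5, sgn_zero] at h
  rw [sgn_odd (by decide), sgn_even (by decide), sgn_even (by decide), sgn_even (by decide),
    sgn_odd (((even_two_mul d₂).add_odd (by decide) : Odd (2 * d₂ + 9)))] at h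
  rw [← h]
  abel

/-- After the vanishing, the relations for `(a, b, e, cd)`, `(a, be, c, d)` and `(b, e, c, d)` read
`m₃(ab, e, cd) = m₃(a, be, cd) + a m₃(b, e, cd)`, `m₃(a, be, cd) = m₃(a, be, c) d + a m₃(be, c, d)`
and `m₃(b, e, cd) = m₃(b, ec, d) - m₃(be, c, d)`. On substitution the terms `a m₃(be, c, d)` cancel.
-/
theorem AInfStructure.IsAdmissible.triple_mul {A : AInfStructure T}
    (hA : A.IsAdmissible τ) {X₀ X₁ X₂ X₃ X₄ X₅ : LineBundle k K}
    (hT : T.Coll [X₀, X₁, X₂, X₃, X₄, X₅]) {a : Hom X₀ X₁} {b : Hom X₁ X₂} {e : Hom X₂ X₃}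
    {c : Hom X₃ X₄} {d : Hom X₄ X₅} (ha : a ∈ homog _ _ 0) (hb : b ∈ homog _ _ 0)
    (he : e ∈ homog _ _ 1) (hc : c ∈ homog _ _ 0) (hd : d ∈ homog _ _ 0)
    (h03 : Subsingleton (Hom X₀ X₃)) (h14 : Subsingleton (Hom X₁ X₄))
    (h25 : Subsingleton (Hom X₂ X₅)) :
    A.m (.triple (comp a b) e (comp c d)) =
      comp (A.m (.triple a (comp b e) c)) d + comp a (A.m (.triple b (comp e c) d)) := by
  obtain ⟨⟨r01, r02, r03, r04, r05⟩, hT'⟩ := coll_six.1 hT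
  obtain ⟨⟨r12, r13, r14, r15⟩, hT''⟩ := coll_five.1 hT'
  obtain ⟨⟨r23, r24, r25⟩, ⟨r34, r35⟩, r45⟩ := coll_four.1 hT''
  have z1 : ∀ x : Hom X₂ X₅, A.m (.triple a b x) = 0 := fun x => by
    rw [Subsingleton.elim x 0]
    exact IsMultilinear.map_zero A.multilinear (.cons a (.single b)) (.nil _)
      (coll_four.2 ⟨⟨r01, r02, r05⟩, ⟨r12, r15⟩, r25⟩)
  have z2 : ∀ x : Hom X₀ X₃, A.m (.triple x c d) = 0 := fun x => by
    rw [Subsingleton.elim x 0]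
    exact IsMultilinear.map_zero A.multilinear (.nil _) (.cons c (.single d))
      (coll_four.2 ⟨⟨r03, r04, r05⟩, ⟨r34, r35⟩, r45⟩)
  have z3 : ∀ x : Hom X₁ X₄, A.m (.triple a x d) = 0 := fun x => by
    rw [Subsingleton.elim x 0]
    exact IsMultilinear.map_zero A.multilinear (.single a) (.single d)
      (coll_four.2 ⟨⟨r01, r04, r05⟩, ⟨r14, r15⟩, r45⟩)
  have e1 := hA.constraint_four (coll_five.2 ⟨⟨r01, r02, r03, r05⟩,
    coll_four.2 ⟨⟨r12, r13, r15⟩, ⟨r23, r25⟩, r35⟩⟩) ha hb he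
    (comp_mem_homog_zero hc hd)
  have e2 := hA.constraint_four (coll_five.2 ⟨⟨r01, r03, r04, r05⟩,
    coll_four.2 ⟨⟨r13, r14, r15⟩, ⟨r34, r35⟩, r45⟩⟩) ha
    (comp_mem_homog_one_right (a := b) he) hc hd
  have e3 := hA.constraint_four hT' hb he hc hd
  rw [z1, Subsingleton.elim (A.m (.triple a b e)) 0, zero_comp] at e1
  rw [z2, z3] at e2
  rw [Subsingleton.elim (A.m (.triple b e c)) 0, zero_comp,
    Subsingleton.elim (A.m (.triple e c d)) 0, comp_zero] at e3
  have e3' : A.m (.triple b e (comp c d)) =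
      A.m (.triple b (comp e c) d) + -A.m (.triple (comp b e) c d) := by
    refine (sub_eq_zero.1 ((neg_eq_zero.1 ?_))).symm
    refine Eq.trans ?_ (neg_eq_zero.2 e3)
    abel
  rw [e3', comp_add, comp_neg] at e1
  refine sub_eq_zero.1 (Eq.trans ?_ (neg_eq_zero.2 ((congrArg₂ (· + ·) e1 e2).trans (add_zero 0))))
  abel

theorem AInfStructure.IsAdmissible.triple_transport {A : AInfStructure T} (hA : A.IsAdmissible τ)
    {N L₁ M L₂ X₀ X₁ X₂ X₃ : LineBundle k K} (g₀ : 0 + N = X₀) (g₁ : L₁ + N = X₁)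
    (g₂ : L₁ + M + N = X₂) (g₃ : L₁ + M + L₂ + N = X₃) (h₁ : L₁ = X₁ - X₀) (h₂ : M = X₂ - X₁)
    (h₃ : L₂ = X₃ - X₂) (s₁ : H0 L₁) (e : H1 M) (s₂ : H0 L₂)
    (hT : T.Coll [X₀, X₁, X₂, X₃]) :
    ((A.m (.triple (.of0 h₁ s₁) (.of1 h₂ e) (.of0 h₃ s₂))).1 : K) = (A.m3 s₁ e s₂).1 := by
  subst g₀ g₁ g₂ g₃
  have hT' : T.Coll [0, L₁, L₁ + M, L₁ + M + L₂] := by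
    rw [coll_four] at hT ⊢
    rw [T.tensor 0 L₁ N, T.tensor 0 (L₁ + M) N, T.tensor 0 (L₁ + M + L₂) N, T.tensor L₁ (L₁ + M) N,
      T.tensor L₁ (L₁ + M + L₂) N, T.tensor (L₁ + M) (L₁ + M + L₂) N]
    exact hT
  have h := hA.m_tensor N (.triple (.of0 (sub_zero L₁).symm s₁)
    (.of1 (add_sub_cancel_left L₁ M).symm e) (.of0 (add_sub_cancel_left (L₁ + M) L₂).symm s₂)) hT'
    (Nat.succ_ne_zero _)
  have e1 : tensor N (Hom.of1 (add_sub_cancel_left L₁ M).symm e) = Hom.of1 h₂ e :=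
    Prod.ext rfl (H1.cast_cast _ _ _)
  have e0 : tensor N (Hom.of0 (X := 0) (sub_zero L₁).symm s₁) = Hom.of0 h₁ s₁ :=
    Prod.ext rfl (_root_.map_zero _)
  have e2 : tensor N (Hom.of0 (add_sub_cancel_left (L₁ + M) L₂).symm s₂) = Hom.of0 h₃ s₂ :=
    Prod.ext rfl (_root_.map_zero _)
  simp only [Chain.triple, Chain.single, tensorChain, e0, e1, e2] at h
  exact congrArg (fun x => (x.1 : K)) h

/-- The triple product along any chain `X₀ ⟶ X₁ ⟶ X₂ ⟶ X₃`. -/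
theorem AInfStructure.IsAdmissible.triple_eq_m3 {A : AInfStructure T}
    (hA : A.IsAdmissible τ) {L₁ M L₂ X₀ X₁ X₂ X₃ : LineBundle k K}
    (h₁ : L₁ = X₁ - X₀) (h₂ : M = X₂ - X₁) (h₃ : L₂ = X₃ - X₂) (s₁ : H0 L₁) (e : H1 M) (s₂ : H0 L₂)
    (hT : T.Coll [X₀, X₁, X₂, X₃]) :
    ((A.m (.triple (.of0 h₁ s₁) (.of1 h₂ e) (.of0 h₃ s₂))).1 : K) = (A.m3 s₁ e s₂).1 :=
  hA.triple_transport (N := X₀) (by abel) (by rw [h₁]; abel) (by rw [h₁, h₂]; abel)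
    (by rw [h₁, h₂, h₃]; abel) h₁ h₂ h₃ s₁ e s₂ hT

theorem AInfStructure.IsAdmissible.m3_mul_mul {A : AInfStructure T}
    (hA : A.IsAdmissible τ) {L₁' L₁'' M L₂' L₂'' : LineBundle k K}
    (hT : T.Coll [0, L₁', L₁' + L₁'', L₁' + L₁'' + M, L₁' + L₁'' + M + L₂',
      L₁' + L₁'' + M + (L₂' + L₂'')])
    (h03 : Subsingleton (Hom 0 (L₁' + L₁'' + M)))
    (h14 : Subsingleton (Hom L₁' (L₁' + L₁'' + M + L₂')))
    (h25 : Subsingleton (Hom (L₁' + L₁'') (L₁' + L₁'' + M + (L₂' + L₂''))))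
    (s₁' : H0 L₁') (s₁'' : H0 L₁'') (e : H1 M) (s₂' : H0 L₂') (s₂'' : H0 L₂'') :
    ((A.m3 (mul00 s₁' s₁'') e (mul00 s₂' s₂'')).1 : K) =
      (A.m3 s₁' (mul01 s₁'' e) s₂').1 * s₂''.1 + s₁'.1 * (A.m3 s₁'' (mul10 e s₂') s₂'').1 := by
  obtain ⟨⟨r01, r02, r03, r04, r05⟩, hT'⟩ := coll_six.1 hT
  obtain ⟨⟨r12, r13, r14, r15⟩, hT''⟩ := coll_five.1 hT'
  obtain ⟨⟨r23, r24, r25⟩, ⟨r34, r35⟩, r45⟩ := coll_four.1 hT''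
  have h₁ : L₁' = L₁' - 0 := by abel
  have h₂ : L₁'' = L₁' + L₁'' - L₁' := by abel
  have h₃ : M = L₁' + L₁'' + M - (L₁' + L₁'') := by abel
  have h₄ : L₂' = L₁' + L₁'' + M + L₂' - (L₁' + L₁'' + M) := by abel
  have h₅ : L₂'' = L₁' + L₁'' + M + (L₂' + L₂'') - (L₁' + L₁'' + M + L₂') := by abel
  have h := hA.triple_mul hT (of0_mem_homog h₁ s₁') (of0_mem_homog h₂ s₁'') (of1_mem_homog h₃ e)
    (of0_mem_homog h₄ s₂') (of0_mem_homog h₅ s₂'') h03 h14 h25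
  rw [comp_of0_of0 h₁ h₂ (by abel), comp_of0_of0 h₄ h₅ (by abel), comp_of0_of1 h₂ h₃ (by abel),
    comp_of1_of0 h₃ h₄ (by abel)] at h
  have h' := congrArg (fun x => (x.1 : K)) h
  rw [hA.triple_eq_m3 _ _ _ _ _ _ (coll_four.2 ⟨⟨r02, r03, r05⟩, ⟨r23, r25⟩, r35⟩)] at h'
  rw [h', ← hA.triple_eq_m3 h₁ (by abel) h₄ _ _ _ (coll_four.2 ⟨⟨r01, r03, r04⟩, ⟨r13, r14⟩, r34⟩),
    ← hA.triple_eq_m3 h₂ (by abel) h₅ _ _ _ (coll_four.2 ⟨⟨r12, r14, r15⟩, ⟨r24, r25⟩, r45⟩)]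
  rfl

end Products

/-- Each `f₂` and inner `m₂` lands in a zero space, so the morphism equation on `(a, e, c)` reduces
to `m'₃ = m₃`. The term `m'₁(f₃)` is zero because `f₃` is, so no admissibility of `A'` enters. -/
theorem Homotopy.triple_eq {T : Transversality k K} {τ : RegularDifferential k K}
    {A A' : AInfStructure T} (hA : A.IsAdmissible τ) (f : Homotopy A A')
    {X₀ X₁ X₂ X₃ : LineBundle k K} (hT : T.Coll [X₀, X₁, X₂, X₃]) {a : Hom X₀ X₁} {e : Hom X₁ X₂}
    {c : Hom X₂ X₃} (ha : a ∈ homog _ _ 0) (he : e ∈ homog _ _ 1) (hc : c ∈ homog _ _ 0)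
    (h02 : Subsingleton (Hom X₀ X₂)) (h13 : Subsingleton (Hom X₁ X₃)) :
    A'.m (.triple a e c) = A.m (.triple a e c) := by
  have h := f.morphism (.triple a e c) [0, 1, 0] hT (Nat.succ_ne_zero _) ⟨ha, he, hc, trivial⟩
  obtain ⟨⟨r01, r02, r03⟩, ⟨r12, r13⟩, r23⟩ := coll_four.1 hT
  have c1 : T.Coll [X₀, X₂, X₃] := by simp [Transversality.Coll, r02, r03, r23]
  have c2 : T.Coll [X₀, X₁, X₃] := by simp [Transversality.Coll, r01, r03, r13]
  have c3 : T.Coll [X₀, X₃] := by simp [Transversality.Coll, r03]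
  have z1 := IsMultilinear.map_zero f.multilinear (.nil X₀) (.cons e (.single c)) hT
  have z2 := IsMultilinear.map_zero f.multilinear (.single a) (.single c) hT
  have z3 := IsMultilinear.map_zero f.multilinear (.cons a (.single e)) (.nil X₃) hT
  have z4 := IsMultilinear.map_zero f.multilinear (.nil X₀) (.single c) c1
  have z5 := IsMultilinear.map_zero f.multilinear (.single a) (.nil X₃) c2
  have z6 := IsMultilinear.map_zero A'.multilinear (.nil X₀) (.single c) c1
  have z7 := IsMultilinear.map_zero A'.multilinear (.single a) (.nil X₃) c2
  have z8 := IsMultilinear.map_zero A'.multilinear (.nil X₀) (.nil X₃) c3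
  -- `f₃` has degree `-2` and the arguments have total degree `1`, so its value lies in degree `-1`.
  have z9 : f.f (.triple a e c) = 0 := by
    have := f.degree (.triple a e c) [0, 1, 0] hT (Nat.succ_ne_zero _) ⟨ha, he, hc, trivial⟩
    simpa [Chain.length, Chain.single, homog] using this
  have o1 := hA.m_one a r01
  have o2 := hA.m_one e r12
  have o3 := hA.m_one c r23
  have f1 := f.f_one a r01
  have f2 := f.f_one e r12
  have f3 := f.f_one c r23
  have f4 := f.f_one (A.m (.triple a e c)) r03
  have s1 : A.m (.cons a (.single e)) = 0 := Subsingleton.elim _ _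
  have s2 : A.m (.cons e (.single c)) = 0 := Subsingleton.elim _ _
  have s3 : f.f (.cons a (.single e)) = 0 := Subsingleton.elim _ _
  have s4 : f.f (.cons e (.single c)) = 0 := Subsingleton.elim _ _
  simp only [Chain.triple, Chain.single, Chain.append] at *
  simp [morphismLeft, morphismRight, Chain.blocks, Chain.blockLengths, Chain.map, Chain.splits,
    Chain.append, Chain.length, Chain.single, *, sgn_zero] at h
  have m0 : mu [0] = 0 := rfl
  have m1 : mu [1] = 0 := rfl
  have m2 : mu [0, 1, 0] = 4 := rfl
  rw [m0, m1, m2, sgn_even (by decide), sgn_even (by decide)] at h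
  exact h

end LineBundleAInf

end

/-! ### Splitting sections into products with factors of degree one. -/

noncomputable section

namespace LineBundleAInf
universe u
variable {k K : Type u} [Field k] [Field K] [Algebra k K]

theorem LineBundle.Iso.symm {D D' : LineBundle k K} (h : D.Iso D') : D'.Iso D := by
  obtain ⟨f, hf, h⟩ := h
  refine ⟨f⁻¹, inv_ne_zero hf, fun v => ?_⟩
  rw [map_inv₀, h, ← WithZero.exp_neg, neg_sub]

theorem LineBundle.Iso.trans {D D' D'' : LineBundle k K} (h : D.Iso D') (h' : D'.Iso D'') :
    D.Iso D'' := by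
  obtain ⟨f, hf, h⟩ := h
  obtain ⟨g, hg, h'⟩ := h'
  refine ⟨f * g, mul_ne_zero hf hg, fun v => ?_⟩
  rw [map_mul, h, h', ← WithZero.exp_add]
  congr 1
  ring

/-- A section exists because `χ(L) = 1`. Its zero divisor is effective of degree one, hence a single
rational point. -/
theorem GenusOne.exists_section_of_degree_one (G : GenusOne k K) {L : LineBundle k K}
    (hL : L.degree = 1) : ∃ v : Place k K, v.degree = 1 ∧ ∃ s ∈ H0 L, s ≠ 0 ∧
      ∀ w : Place k K, w.val s = WithZero.exp (L w - (Finsupp.single v 1 : LineBundle k K) w) := by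
  have e := (G.hasEuler L).euler
  have := (G.hasEuler L).finite0
  have hpos : 0 < Module.finrank k (H0 L) := by omega
  obtain ⟨⟨s, hs⟩, hs0⟩ := (Module.finrank_pos_iff_exists_ne_zero (R := k)).1 hpos
  have hs0 : s ≠ 0 := fun h => hs0 (Subtype.ext h)
  obtain h | ⟨v, hv⟩ := exists_mem_H0_sub_single hs
  · have : s⁻¹ ∈ H0 (-L) := fun v => by
      rw [map_inv₀, h, ← WithZero.exp_neg, Finsupp.neg_apply]
    have := G.degree_nonneg this (inv_ne_zero hs0)
    rw [LineBundle.degree_neg, hL] at this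
    omega
  · have h1 := G.degree_nonneg hv hs0
    have := G.finite_residue v
    have h2 := v.degree_pos
    rw [LineBundle.degree_sub, LineBundle.degree_single, hL] at h1
    have hdeg : (L - Finsupp.single v 1).degree = 0 := by
      rw [LineBundle.degree_sub, LineBundle.degree_single, hL]
      omega
    exact ⟨v, by omega, s, hs, hs0, fun w => by
      rw [G.val_eq_of_degree_zero hv hs0 hdeg w, Finsupp.sub_apply]⟩

theorem single_apply_nonneg (v w : Place k K) {n : ℤ} (hn : 0 ≤ n) :
    0 ≤ (Finsupp.single v n : LineBundle k K) w := by
  classical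
  rw [Finsupp.single_apply]
  split_ifs
  · exact hn
  · exact le_rfl

/-- If `H¹(L(-p-q)) = 0` then `H⁰(L) = H⁰(L(-p)) + H⁰(L(-q))`. -/
theorem exists_add_of_subsingleton_H1 {L : LineBundle k K} {p q : Place k K} (hpq : p ≠ q)
    (hp : p.degree = 1)
    (hH : Subsingleton (H1 (L - Finsupp.single q 1 - Finsupp.single p 1))) {s : K} (hs : s ∈ H0 L) :
    ∃ f ∈ H0 (L - Finsupp.single p 1), ∃ g ∈ H0 (L - Finsupp.single q 1), s = f + g := by
  obtain ⟨φ, ψ, h, h₁, h₂, -⟩ := exact_place (L - Finsupp.single q 1 - Finsupp.single p 1) p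
  -- The obstruction to a section of `L(-q)` having residue `1` at `p` lies in `H¹(L(-q-p))`, so
  -- there is such a `g`.
  obtain ⟨g, hg⟩ := (h₂ 1).1 (Subsingleton.elim _ _)
  have hgq : g.1 ∈ H0 (L - Finsupp.single q 1) :=
    (congrArg (g.1 ∈ H0 ·) (sub_add_cancel _ _)).mp g.2
  have hgp : g.1 ∉ H0 (L - Finsupp.single p 1) := by
    intro hgp
    have : g.1 ∈ H0 (L - Finsupp.single q 1 - Finsupp.single p 1) := by
      intro w
      by_cases hw : w = p
      · have := hgp w
        rw [Finsupp.sub_apply, Finsupp.sub_apply, Finsupp.single_eq_of_ne (hw ▸ hpq), sub_zero]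
        exact this
      · have := hgq w
        rw [Finsupp.sub_apply, Finsupp.single_eq_of_ne hw, sub_zero]
        exact this
    have h0 := (h₁ g).2 ⟨⟨g.1, this⟩, rfl⟩
    rw [hg] at h0
    exact one_ne_zero h0
  obtain ⟨φ', ψ', h', h₁', -, -⟩ := exact_place (L - Finsupp.single p 1) p
  have hle : ∀ f ∈ H0 L, f ∈ H0 (L - Finsupp.single p 1 + Finsupp.single p 1) := fun f hf => by
    rwa [sub_add_cancel]
  have hgL : g.1 ∈ H0 L := fun w => (hgq w).trans (WithZero.exp_le_exp.2 (by
    rw [Finsupp.sub_apply]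
    have := single_apply_nonneg (k := k) q w zero_le_one
    omega))
  have hφg : φ' ⟨g.1, hle _ hgL⟩ ≠ 0 := by
    intro h0
    obtain ⟨x, hx⟩ := (h₁' _).1 h0
    apply hgp
    have := congrArg Subtype.val hx
    exact this ▸ x.2
  -- As `p` is rational, a multiple of `g` matches the residue of `s` at `p`, and the difference
  -- vanishes at `p`.
  obtain ⟨c, hc⟩ := exists_smul_eq_of_finrank_eq_one hp hφg (φ' ⟨s, hle _ hs⟩)
  have h0 : φ' (⟨s, hle _ hs⟩ - c • ⟨g.1, hle _ hgL⟩) = 0 := by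
    rw [map_sub, map_smul, hc, sub_self]
  obtain ⟨x, hx⟩ := (h₁' _).1 h0
  have hx' := congrArg Subtype.val hx
  refine ⟨x.1, x.2, c • g.1, Submodule.smul_mem _ c hgq, ?_⟩
  have e : x.1 = s - c • g.1 := hx'
  rw [e, sub_add_cancel]

theorem div_mem_H0 {L L' : LineBundle k K} {v : Place k K} {s f : K}
    (hs : ∀ w : Place k K, w.val s = WithZero.exp (L' w - (Finsupp.single v 1 : LineBundle k K) w))
    (hf : f ∈ H0 (L - Finsupp.single v 1)) : f / s ∈ H0 (L - L') := by
  intro w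
  have h1 := hf w
  rw [map_div₀, hs, div_le_iff₀ WithZero.exp_pos, ← WithZero.exp_add]
  refine h1.trans (WithZero.exp_le_exp.2 (le_of_eq ?_))
  rw [Finsupp.sub_apply, Finsupp.sub_apply]
  ring

theorem subsingleton_H1_of_le {D D' : LineBundle k K} (h : D ≤ D') (hD : Subsingleton (H1 D)) :
    Subsingleton (H1 D') :=
  (Submodule.factor_surjective (coboundary_mono h)).subsingleton

/-- A section of a line bundle of degree at least two is a sum of two products `s' a`, with `s'` a

section of a bundle of degree one which is transversal to finitely many given ones. -/
theorem GenusOne.exists_section_decomposition (G : GenusOne k K) (T : Transversality k K)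
    {L : LineBundle k K} {n : ℕ} (hn : 0 < n) (hL : L.degree = n + 1)
    (F : Finset (LineBundle k K)) (s : H0 L) :
    ∃ (L' L'' : LineBundle k K) (s' : H0 L') (a : H0 (L - L')) (s'' : H0 L'') (b : H0 (L - L'')),
      L'.degree = 1 ∧ L''.degree = 1 ∧ (∀ N ∈ F, T.rel L' N) ∧ (∀ N ∈ F, T.rel L'' N) ∧
      s.1 = s'.1 * a.1 + s''.1 * b.1 := by
  obtain ⟨S, hSinf, hSpair, hS⟩ := T.infinite F 1
  have hsec : ∀ {X : LineBundle k K} {v : Place k K} {s : K}, s ≠ 0 → (∀ w : Place k K, w.val s =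
      WithZero.exp (X w - (Finsupp.single v 1 : LineBundle k K) w)) →
      LineBundle.Iso (Finsupp.single v 1) X := fun h h' => ⟨_, h, h'⟩
  obtain ⟨L', hL'⟩ := hSinf.nonempty
  obtain ⟨p, hp, s', hs'L, hs'0, hs'⟩ := G.exists_section_of_degree_one (hS L' hL').1
  -- At most one isomorphism class is that of `L(-np)`, so of two further members of `S` at least
  -- one avoids it.
  obtain ⟨L'', hL'', hne, hniso⟩ : ∃ L'' ∈ S, L'' ≠ L' ∧
      ¬ L''.Iso (L - Finsupp.single p (n : ℤ)) := by
    obtain ⟨x, hx, hxL⟩ := (hSinf.sdiff (Set.finite_singleton L')).nonempty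
    obtain ⟨y, hy, hyL⟩ := (hSinf.sdiff ((Set.finite_singleton L').insert x)).nonempty
    simp only [Set.mem_singleton_iff, Set.mem_insert_iff, not_or] at hxL hyL
    by_cases hxZ : x.Iso (L - Finsupp.single p (n : ℤ))
    · exact ⟨y, hy, hyL.2, fun hyZ => hSpair hy hx hyL.1 (hyZ.trans hxZ.symm)⟩
    · exact ⟨x, hx, hxL, hxZ⟩
  obtain ⟨q, hq, s'', hs''L, hs''0, hs''⟩ := G.exists_section_of_degree_one (hS L'' hL'').1
  have hpq : p ≠ q := by
    rintro rfl
    exact hSpair hL'' hL' hne ((hsec hs''0 hs'').symm.trans (hsec hs'0 hs'))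
  -- `L(-np-q)` has degree zero and is nontrivial since `L'' ≃ 𝒪(q)` is not `L(-np)`. The vanishing
  -- then passes to the larger `L(-q-p)`.
  have h1 : Subsingleton (H1 (L - Finsupp.single p (n : ℤ) - Finsupp.single q 1)) := by
    refine G.subsingleton_H1 ?_ fun h => hniso ((hsec hs''0 hs'').symm.trans h)
    rw [LineBundle.degree_sub, LineBundle.degree_sub, LineBundle.degree_single,
      LineBundle.degree_single, hL, hp, hq]
    push_cast
    ring
  have h2 : Subsingleton (H1 (L - Finsupp.single q 1 - Finsupp.single p 1)) := by
    refine subsingleton_H1_of_le (fun w => ?_) h1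
    obtain ⟨m, rfl⟩ : ∃ m, n = m + 1 := ⟨n - 1, by omega⟩
    have := single_apply_nonneg (k := k) p w (Int.natCast_nonneg m)
    rw [Finsupp.sub_apply, Finsupp.sub_apply, Finsupp.sub_apply, Finsupp.sub_apply, Nat.cast_add,
      Finsupp.single_add, Finsupp.add_apply, Nat.cast_one]
    omega
  obtain ⟨f, hf, g, hg, hfg⟩ := exists_add_of_subsingleton_H1 hpq hp h2 s.2
  exact ⟨L', L'', ⟨s', hs'L⟩, ⟨_, div_mem_H0 hs' hf⟩, ⟨s'', hs''L⟩, ⟨_, div_mem_H0 hs'' hg⟩,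
    (hS L' hL').1, (hS L'' hL'').1, fun N hN => ((hS L' hL').2 N hN).1,
    fun N hN => ((hS L'' hL'').2 N hN).1, by
      rw [hfg]
      exact (congrArg₂ (· + ·) (mul_div_cancel₀ f hs'0) (mul_div_cancel₀ g hs''0)).symm⟩

end LineBundleAInf

end

/-! ### Reduction to triple products of degrees `(1, -1, 1)`. -/

noncomputable section

namespace LineBundleAInf
universe u
variable {k K : Type u} [Field k] [Field K] [Algebra k K]

section Reduction

variable {T : Transversality k K} {τ : RegularDifferential k K}

theorem Hom.of0_add {L X Y : LineBundle k K} (h : L = Y - X) (s t : H0 L) :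
    Hom.of0 h (s + t) = Hom.of0 h s + Hom.of0 h t := by
  subst h
  exact Prod.ext rfl (add_zero _).symm

theorem AInfStructure.add_m3 (A : AInfStructure T) {L₁ M L₂ : LineBundle k K}
    (hT : T.Coll [0, L₁, L₁ + M, L₁ + M + L₂]) (s t : H0 L₁) (e : H1 M) (s₂ : H0 L₂) :
    ((A.m3 (s + t) e s₂).1 : K) = (A.m3 s e s₂).1 + (A.m3 t e s₂).1 := by
  have h := (A.multilinear (.nil 0) (.cons (Hom.of1 (X := L₁) (Y := L₁ + M)
    (add_sub_cancel_left L₁ M).symm e) (.single (Hom.of0 (X := L₁ + M) (Y := L₁ + M + L₂)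
      (add_sub_cancel_left (L₁ + M) L₂).symm s₂))) 0 hT).map_add
    (Hom.of0 (sub_zero L₁).symm s) (Hom.of0 (sub_zero L₁).symm t)
  rw [← Hom.of0_add] at h
  exact congrArg (fun x => (x.1 : K)) h

theorem AInfStructure.m3_add (A : AInfStructure T) {L₁ M L₂ : LineBundle k K}
    (hT : T.Coll [0, L₁, L₁ + M, L₁ + M + L₂]) (s₁ : H0 L₁) (e : H1 M) (s t : H0 L₂) :
    ((A.m3 s₁ e (s + t)).1 : K) = (A.m3 s₁ e s).1 + (A.m3 s₁ e t).1 := by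
  have h := (A.multilinear (.cons (Hom.of0 (sub_zero L₁).symm s₁) (.single (Hom.of1 (X := L₁)
    (Y := L₁ + M) (add_sub_cancel_left L₁ M).symm e))) (.nil (L₁ + M + L₂)) 0 hT).map_add
    (Hom.of0 (add_sub_cancel_left (L₁ + M) L₂).symm s)
    (Hom.of0 (add_sub_cancel_left (L₁ + M) L₂).symm t)
  rw [← Hom.of0_add] at h
  exact congrArg (fun x => (x.1 : K)) h

variable (T τ) in
/-- The functions `A ↦ b m₃(p, q, r) c` of the admissible structure `A`, with values in the sections
of `D`, where `p`, `q`, `r` are classes of bundles of degrees `1`, `-1`, `1`. -/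
def unitTriples (D : LineBundle k K) : Set ({A : AInfStructure T // A.IsAdmissible τ} → K) :=
  {Φ | ∃ (B P Q R C : LineBundle k K) (b : H0 B) (p : H0 P) (q : H1 Q) (r : H0 R) (c : H0 C),
    (P.degree = 1 ∧ Q.degree = -1 ∧ R.degree = 1 ∧ T.Coll [0, P, P + Q, P + Q + R] ∧
      B + (P + Q + R) + C = D) ∧ ∀ A, Φ A = b.1 * (A.1.m3 p q r).1 * c.1}

variable (T τ) in
/-- The finite sums of members of `unitTriples T τ D`. -/
def unitTripleSums (D : LineBundle k K) :
    AddSubmonoid ({A : AInfStructure T // A.IsAdmissible τ} → K) :=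
  AddSubmonoid.closure (unitTriples T τ D)

/-- Working with functions of `A` makes the decompositions uniform in the admissible structure. The
induction only multiplies its hypothesis by a section on the left. -/
theorem mul_mem_unitTripleSums {D X : LineBundle k K} (x : H0 X)
    {Φ : {A : AInfStructure T // A.IsAdmissible τ} → K} (h : Φ ∈ unitTripleSums T τ D) :
    (fun A => x.1 * Φ A) ∈ unitTripleSums T τ (X + D) := by
  induction h using AddSubmonoid.closure_induction with
  | mem Φ h =>
    obtain ⟨B, P, Q, R, C, b, p, q, r, c, ⟨h₁, h₂, h₃, h₄, rfl⟩, h⟩ := h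
    refine AddSubmonoid.subset_closure ⟨X + B, P, Q, R, C, mul00 x b, p, q, r, c,
      ⟨h₁, h₂, h₃, h₄, by abel⟩, fun A => ?_⟩
    change x.1 * Φ A = x.1 * b.1 * (A.1.m3 p q r).1 * c.1
    rw [h]
    ring
  | zero =>
    convert (unitTripleSums T τ (X + D)).zero_mem using 1
    exact funext fun A => mul_zero _
  | add Φ Ψ _ _ h h' =>
    convert (unitTripleSums T τ (X + D)).add_mem h h' using 1
    exact funext fun A => mul_add _ _ _

theorem exists_sum_of_mem_unitTripleSums {D : LineBundle k K}
    {Φ : {A : AInfStructure T // A.IsAdmissible τ} → K} (h : Φ ∈ unitTripleSums T τ D) :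
    ∃ (N : ℕ) (B P Q R C : Fin N → LineBundle k K) (b : ∀ j, H0 (B j)) (p : ∀ j, H0 (P j))
      (q : ∀ j, H1 (Q j)) (r : ∀ j, H0 (R j)) (c : ∀ j, H0 (C j)),
      (∀ j, (P j).degree = 1 ∧ (Q j).degree = -1 ∧ (R j).degree = 1 ∧
        T.Coll [0, P j, P j + Q j, P j + Q j + R j] ∧ B j + (P j + Q j + R j) + C j = D) ∧
      ∀ A, Φ A = ∑ j, (b j).1 * (A.1.m3 (p j) (q j) (r j)).1 * (c j).1 := by
  obtain ⟨l, hl, rfl⟩ := AddSubmonoid.exists_list_of_mem_closure h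
  choose B P Q R C b p q r c hd hv using fun j : Fin l.length => hl _ (l.get_mem j)
  refine ⟨l.length, B, P, Q, R, C, b, p, q, r, c, hd, fun A => ?_⟩
  have e : l.sum = ∑ j : Fin l.length, l.get j := by
    rw [← List.sum_ofFn, List.ofFn_get]
  rw [e, Finset.sum_apply]
  exact Finset.sum_congr rfl fun j _ => hv j A

theorem one_mem_H0 : (1 : K) ∈ H0 (0 : LineBundle k K) := fun v => by
  rw [map_one, Finsupp.zero_apply, WithZero.exp_zero]

/-- The inductive step: in the identity with `n' = 1` the first term is already of degrees `(1, -1,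
1)`, with `b = 1` and `c = s₂''`, and the second falls under `ih`. -/
theorem GenusOne.m3_mul_mul_mem (G : GenusOne k K) {n : ℕ}
    {L₁ L₁' L₁'' M L₂ L₂' L₂'' : LineBundle k K}
    (ih : T.Coll [0, L₁'', L₁'' + (M + L₂'), L₁'' + (M + L₂') + L₂''] →
      ∀ (s₁ : H0 L₁'') (e : H1 (M + L₂')) (s₂ : H0 L₂''),
        (fun A : {A : AInfStructure T // A.IsAdmissible τ} => ((A.1.m3 s₁ e s₂).1 : K)) ∈
          unitTripleSums T τ (L₁'' + (M + L₂') + L₂''))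
    (h₁ : L₁' + L₁'' = L₁) (h₂ : L₂' + L₂'' = L₂)
    (d₁' : L₁'.degree = 1) (d₁ : L₁.degree = n + 1) (d₂' : L₂'.degree = 1) (d₂ : L₂.degree = n + 1)
    (d : M.degree = -(n + 1))
    (hT : T.Coll [0, L₁', L₁, L₁ + M, L₁ + M + L₂', L₁ + M + L₂])
    (s₁' : H0 L₁') (s₁'' : H0 L₁'') (e : H1 M) (s₂' : H0 L₂') (s₂'' : H0 L₂'') {s₁ : H0 L₁}
    {s₂ : H0 L₂} (hs₁ : s₁.1 = s₁'.1 * s₁''.1) (hs₂ : s₂.1 = s₂'.1 * s₂''.1) :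
    (fun A : {A : AInfStructure T // A.IsAdmissible τ} => ((A.1.m3 s₁ e s₂).1 : K)) ∈
      unitTripleSums T τ (L₁ + M + L₂) := by
  subst h₁ h₂
  obtain rfl : s₁ = mul00 s₁' s₁'' := Subtype.ext hs₁
  obtain rfl : s₂ = mul00 s₂' s₂'' := Subtype.ext hs₂
  obtain ⟨⟨r01, r02, r03, r04, r05⟩, hT'⟩ := coll_six.1 hT
  obtain ⟨⟨r12, r13, r14, r15⟩, hT''⟩ := coll_five.1 hT'
  obtain ⟨⟨r23, r24, r25⟩, ⟨r34, r35⟩, r45⟩ := coll_four.1 hT''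
  rw [LineBundle.degree_add] at d₁ d₂
  have h03 : Subsingleton (Hom 0 (L₁' + L₁'' + M)) := G.subsingleton_Hom (by
    simp only [LineBundle.degree_sub, LineBundle.degree_add, LineBundle.degree_zero]
    omega) (T.not_iso _ _ r03)
  have h14 : Subsingleton (Hom L₁' (L₁' + L₁'' + M + L₂')) := G.subsingleton_Hom (by
    simp only [LineBundle.degree_sub, LineBundle.degree_add]
    omega) (T.not_iso _ _ r14)
  have h25 : Subsingleton (Hom (L₁' + L₁'') (L₁' + L₁'' + M + (L₂' + L₂''))) :=
    G.subsingleton_Hom (by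
      simp only [LineBundle.degree_sub, LineBundle.degree_add]
      omega) (T.not_iso _ _ r25)
  have key : (fun A : {A : AInfStructure T // A.IsAdmissible τ} =>
      ((A.1.m3 (mul00 s₁' s₁'') e (mul00 s₂' s₂'')).1 : K)) =
      (fun A => (A.1.m3 s₁' (mul01 s₁'' e) s₂').1 * s₂''.1) +
        fun A => s₁'.1 * (A.1.m3 s₁'' (mul10 e s₂') s₂'').1 :=
    funext fun A => A.2.m3_mul_mul hT h03 h14 h25 s₁' s₁'' e s₂' s₂''
  rw [key]
  refine AddSubmonoid.add_mem _ (AddSubmonoid.subset_closure ⟨0, L₁', L₁'' + M, L₂', L₂'',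
    ⟨1, one_mem_H0⟩, s₁', mul01 s₁'' e, s₂', s₂'', ⟨d₁', ?_, d₂', ?_, by abel⟩, fun A => ?_⟩) ?_
  · rw [LineBundle.degree_add]
    omega
  · rw [← add_assoc]
    exact coll_four.2 ⟨⟨r01, r03, r04⟩, ⟨r13, r14⟩, r34⟩
  · rw [one_mul]
  · have := mul_mem_unitTripleSums s₁' (ih ?_ s₁'' (mul10 e s₂') s₂'')
    · rwa [show L₁' + (L₁'' + (M + L₂') + L₂'') = L₁' + L₁'' + M + (L₂' + L₂'') by abel] at this
    -- The smaller triple product lives on the chain starting at `L₁'`; translation by `L₁'` brings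
    -- it to the chain starting at `𝒪`.
    · have t : ∀ {X Y X' Y' : LineBundle k K}, T.rel X' Y' → X' = X + L₁' → Y' = Y + L₁' →
          T.rel X Y := fun h hX hY => (T.tensor _ _ L₁').2 (hX ▸ hY ▸ h)
      exact coll_four.2 ⟨⟨t r12 (by abel) (by abel), t r14 (by abel) (by abel),
        t r15 (by abel) (by abel)⟩, ⟨t r24 (by abel) (by abel), t r25 (by abel) (by abel)⟩,
        t r45 (by abel) (by abel)⟩

theorem GenusOne.m3_mem_unitTripleSums (G : GenusOne k K) (n : ℕ) : ∀ (L₁ M L₂ : LineBundle k K),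
    L₁.degree = n + 1 → M.degree = -(n + 1 : ℤ) → L₂.degree = n + 1 →
    T.Coll [0, L₁, L₁ + M, L₁ + M + L₂] → ∀ (s₁ : H0 L₁) (e : H1 M) (s₂ : H0 L₂),
    (fun A : {A : AInfStructure T // A.IsAdmissible τ} => ((A.1.m3 s₁ e s₂).1 : K)) ∈
      unitTripleSums T τ (L₁ + M + L₂) := by
  induction n with
  | zero =>
    intro L₁ M L₂ d₁ d d₂ hT s₁ e s₂
    refine AddSubmonoid.subset_closure ⟨0, L₁, M, L₂, 0, ⟨1, one_mem_H0⟩, s₁, e, s₂,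
      ⟨1, one_mem_H0⟩, ⟨by simpa using d₁, by simpa using d, by simpa using d₂, hT, by abel⟩,
      fun A => ?_⟩
    rw [one_mul, mul_one]
  | succ n ih =>
    intro L₁ M L₂ d₁ d d₂ hT s₁ e s₂
    classical
    obtain ⟨⟨r01, r02, r03⟩, ⟨r12, r13⟩, r23⟩ := coll_four.1 hT
    -- By additivity `s₁`, then `s₂`, may be taken to be products. `L₁'` is fixed before `L₂'` is
    -- chosen, as the latter must also respect transversality with `L₁'`.
    have main : ∀ (L₁' : LineBundle k K) (s₁' : H0 L₁') (s₁'' : H0 (L₁ - L₁')) (s₁ : H0 L₁),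
        L₁'.degree = 1 → (∀ N ∈ ({0, L₁, L₁ + M, L₁ + M + L₂} : Finset (LineBundle k K)),
          T.rel L₁' N) → s₁.1 = s₁'.1 * s₁''.1 →
        (fun A : {A : AInfStructure T // A.IsAdmissible τ} => ((A.1.m3 s₁ e s₂).1 : K)) ∈
          unitTripleSums T τ (L₁ + M + L₂) := by
      intro L₁' s₁' s₁'' s₁ d₁' hr hs₁
      have main' : ∀ (L₂' : LineBundle k K) (s₂' : H0 L₂') (s₂'' : H0 (L₂ - L₂')) (s₂ : H0 L₂),
          L₂'.degree = 1 → (∀ N ∈ (({0, L₁', L₁, L₁ + M, L₁ + M + L₂} :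
            Finset (LineBundle k K)).image fun N => N - (L₁ + M)), T.rel L₂' N) →
          s₂.1 = s₂'.1 * s₂''.1 →
          (fun A : {A : AInfStructure T // A.IsAdmissible τ} => ((A.1.m3 s₁ e s₂).1 : K)) ∈
            unitTripleSums T τ (L₁ + M + L₂) := by
        intro L₂' s₂' s₂'' s₂ d₂' hr' hs₂
        -- The new object of the chain is `L₁ + M + L₂'`, not `L₂'`; hence the translated collection
        -- in the choice of `L₂'`.
        have hr'' : ∀ N ∈ ({0, L₁', L₁, L₁ + M, L₁ + M + L₂} : Finset (LineBundle k K)),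
            T.rel (L₁ + M + L₂') N := fun N hN => by
          have := (T.tensor _ _ (L₁ + M)).1 (hr' _ (Finset.mem_image_of_mem _ hN))
          rwa [sub_add_cancel, add_comm] at this
        refine G.m3_mul_mul_mem (n := n + 1) (ih _ _ _ ?_ ?_ ?_) (by abel) (by abel) d₁'
          (by exact_mod_cast d₁) d₂' (by exact_mod_cast d₂) (by exact_mod_cast d) ?_
          s₁' s₁'' e s₂' s₂'' hs₁ hs₂
        · rw [LineBundle.degree_sub, d₁, d₁']
          push_cast
          ring
        · rw [LineBundle.degree_add, d, d₂']
          push_cast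
          ring
        · rw [LineBundle.degree_sub, d₂, d₂']
          push_cast
          ring
        · simp only [Finset.mem_insert, Finset.mem_singleton, forall_eq_or_imp, forall_eq]
            at hr hr''
          obtain ⟨r10, r1⟩ := hr
          obtain ⟨r40, r41, r42, r43, r45⟩ := hr''
          exact coll_six.2 ⟨⟨(T.symm _ _).1 r10, r01, r02, (T.symm _ _).1 r40, r03⟩,
            coll_five.2 ⟨⟨r1.1, r1.2.1, (T.symm _ _).1 r41, r1.2.2⟩,
              coll_four.2 ⟨⟨r12, (T.symm _ _).1 r42, r13⟩, ⟨(T.symm _ _).1 r43, r23⟩, r45⟩⟩⟩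
      obtain ⟨L', L'', s', a, s'', b, d', d'', hr', hr'', hs⟩ := G.exists_section_decomposition T
        (Nat.succ_pos n) (by exact_mod_cast d₂) (({0, L₁', L₁, L₁ + M, L₁ + M + L₂} :
          Finset (LineBundle k K)).image fun N => N - (L₁ + M)) s₂
      have e₁ : s₂ = H0.cast (add_sub_cancel L' L₂) (mul00 s' a) +
        H0.cast (add_sub_cancel L'' L₂) (mul00 s'' b) := Subtype.ext hs
      convert AddSubmonoid.add_mem _ (main' L' s' a (H0.cast (add_sub_cancel L' L₂) (mul00 s' a)) d'
        hr' rfl) (main' L'' s'' b (H0.cast (add_sub_cancel L'' L₂) (mul00 s'' b)) d'' hr'' rfl)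
        using 1
      rw [e₁]
      exact funext fun A => A.1.m3_add hT _ _ _ _
    obtain ⟨L', L'', s', a, s'', b, d', d'', hr', hr'', hs⟩ := G.exists_section_decomposition T
      (Nat.succ_pos n) (by exact_mod_cast d₁) {0, L₁, L₁ + M, L₁ + M + L₂} s₁
    have e₁ : s₁ = H0.cast (add_sub_cancel L' L₁) (mul00 s' a) +
      H0.cast (add_sub_cancel L'' L₁) (mul00 s'' b) := Subtype.ext hs
    convert AddSubmonoid.add_mem _ (main L' s' a (H0.cast (add_sub_cancel L' L₁) (mul00 s' a)) d'
      hr' rfl) (main L'' s'' b (H0.cast (add_sub_cancel L'' L₁) (mul00 s'' b)) d'' hr'' rfl)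
      using 1
    rw [e₁]
    exact funext fun A => A.1.add_m3 hT _ _ _ _

end Reduction

theorem GenusOne.m3_mul_mul (G : GenusOne k K) {T : Transversality k K}
    {τ : RegularDifferential k K} {A : AInfStructure T} (hA : A.IsAdmissible τ)
    {n' n'' : ℕ} {L₁' L₁'' M L₂' L₂'' : LineBundle k K}
    (d₁' : L₁'.degree = n') (d₁'' : L₁''.degree = n'') (d₂' : L₂'.degree = n')
    (d₂'' : L₂''.degree = n'') (d : M.degree = -((n' + n'' : ℕ) : ℤ))
    (hT : T.Coll [0, L₁', L₁' + L₁'', L₁' + L₁'' + M, L₁' + L₁'' + M + L₂',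
      L₁' + L₁'' + M + (L₂' + L₂'')])
    (s₁' : H0 L₁') (s₁'' : H0 L₁'') (e : H1 M) (s₂' : H0 L₂') (s₂'' : H0 L₂'') :
    ((A.m3 (mul00 s₁' s₁'') e (mul00 s₂' s₂'')).1 : K) =
      (A.m3 s₁' (mul01 s₁'' e) s₂').1 * s₂''.1 + s₁'.1 * (A.m3 s₁'' (mul10 e s₂') s₂'').1 := by
  obtain ⟨⟨-, -, r03, -, -⟩, hT'⟩ := coll_six.1 hT
  obtain ⟨⟨-, -, r14, -⟩, hT''⟩ := coll_five.1 hT'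
  obtain ⟨⟨-, -, r25⟩, -, -⟩ := coll_four.1 hT''
  exact hA.m3_mul_mul hT
    (G.subsingleton_Hom (by
      simp only [LineBundle.degree_sub, LineBundle.degree_add, LineBundle.degree_zero]
      omega) (T.not_iso _ _ r03))
    (G.subsingleton_Hom (by
      simp only [LineBundle.degree_sub, LineBundle.degree_add]
      omega) (T.not_iso _ _ r14))
    (G.subsingleton_Hom (by
      simp only [LineBundle.degree_sub, LineBundle.degree_add]
      omega) (T.not_iso _ _ r25)) s₁' s₁'' e s₂' s₂''

theorem GenusOne.m3_eq_of_homotopy (G : GenusOne k K) {T : Transversality k K}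
    {τ : RegularDifferential k K} {A A' : AInfStructure T} (hA : A.IsAdmissible τ)
    (f : Homotopy A A') {n : ℕ} {L₁ M L₂ : LineBundle k K} (d₁ : L₁.degree = n)
    (d : M.degree = -(n : ℤ)) (d₂ : L₂.degree = n) (hT : T.Coll [0, L₁, L₁ + M, L₁ + M + L₂])
    (s₁ : H0 L₁) (e : H1 M) (s₂ : H0 L₂) : A'.m3 s₁ e s₂ = A.m3 s₁ e s₂ := by
  obtain ⟨⟨-, r02, -⟩, ⟨-, r13⟩, -⟩ := coll_four.1 hT
  have h := f.triple_eq hA hT (of0_mem_homog (sub_zero L₁).symm s₁)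
    (of1_mem_homog (add_sub_cancel_left L₁ M).symm e)
    (of0_mem_homog (add_sub_cancel_left (L₁ + M) L₂).symm s₂)
    (G.subsingleton_Hom (by
      simp only [LineBundle.degree_sub, LineBundle.degree_add, LineBundle.degree_zero]
      omega) (T.not_iso _ _ r02))
    (G.subsingleton_Hom (by
      simp only [LineBundle.degree_sub, LineBundle.degree_add]
      omega) (T.not_iso _ _ r13))
  exact Subtype.ext (congrArg (fun x => (x.1 : K)) h)

end LineBundleAInf

end

theorem mainTheorem5 {k : Type*} [Field k] (W : WeierstrassCurve k) [W.IsElliptic]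
    (τ : LineBundleAInf.RegularDifferential k W.toAffine.FunctionField) (hτ : τ ≠ 0)
    (T : LineBundleAInf.Transversality k W.toAffine.FunctionField) :
    -- the identity
    (∀ (A : LineBundleAInf.AInfStructure T), A.IsAdmissible τ →
      ∀ (n' n'' : ℕ), 0 < n' → 0 < n'' →
      ∀ (L₁' L₁'' M L₂' L₂'' : LineBundleAInf.LineBundle k W.toAffine.FunctionField),
        L₁'.degree = n' → L₁''.degree = n'' → L₂'.degree = n' → L₂''.degree = n'' →
        M.degree = -((n' + n'' : ℕ) : ℤ) →
        T.Coll [0, L₁', L₁' + L₁'', L₁' + L₁'' + M, L₁' + L₁'' + M + L₂',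
          L₁' + L₁'' + M + (L₂' + L₂'')] →
      ∀ (s₁' : LineBundleAInf.H0 L₁') (s₁'' : LineBundleAInf.H0 L₁'')
        (e : LineBundleAInf.H1 M)
        (s₂' : LineBundleAInf.H0 L₂') (s₂'' : LineBundleAInf.H0 L₂''),
        ((A.m3 (LineBundleAInf.mul00 s₁' s₁'') e (LineBundleAInf.mul00 s₂' s₂'')).1 :
            W.toAffine.FunctionField) =
          (A.m3 s₁' (LineBundleAInf.mul01 s₁'' e) s₂').1 * s₂''.1 +
            s₁'.1 * (A.m3 s₁'' (LineBundleAInf.mul10 e s₂') s₂'').1) ∧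
    -- homotopy invariance of the triple products of degrees `(n, -n, n)`
    (∀ (A A' : LineBundleAInf.AInfStructure T), A.IsAdmissible τ →
      Nonempty (LineBundleAInf.Homotopy A A') →
      ∀ (n : ℕ), 0 < n →
      ∀ (L₁ M L₂ : LineBundleAInf.LineBundle k W.toAffine.FunctionField),
        L₁.degree = n → M.degree = -(n : ℤ) → L₂.degree = n →
        T.Coll [0, L₁, L₁ + M, L₁ + M + L₂] →
      ∀ (s₁ : LineBundleAInf.H0 L₁) (e : LineBundleAInf.H1 M) (s₂ : LineBundleAInf.H0 L₂),
        A'.m3 s₁ e s₂ = A.m3 s₁ e s₂) ∧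
    -- reduction of these triple products to those with `n = 1`
    (∀ (n : ℕ), 0 < n →
      ∀ (L₁ M L₂ : LineBundleAInf.LineBundle k W.toAffine.FunctionField),
        L₁.degree = n → M.degree = -(n : ℤ) → L₂.degree = n →
        T.Coll [0, L₁, L₁ + M, L₁ + M + L₂] →
      ∀ (s₁ : LineBundleAInf.H0 L₁) (e : LineBundleAInf.H1 M) (s₂ : LineBundleAInf.H0 L₂),
      ∃ (N : ℕ) (B P Q R C : Fin N → LineBundleAInf.LineBundle k W.toAffine.FunctionField)
        (b : ∀ j, LineBundleAInf.H0 (B j)) (p : ∀ j, LineBundleAInf.H0 (P j))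
        (q : ∀ j, LineBundleAInf.H1 (Q j)) (r : ∀ j, LineBundleAInf.H0 (R j))
        (c : ∀ j, LineBundleAInf.H0 (C j)),
        (∀ j, (P j).degree = 1 ∧ (Q j).degree = -1 ∧ (R j).degree = 1 ∧
          T.Coll [0, P j, P j + Q j, P j + Q j + R j] ∧
          B j + (P j + Q j + R j) + C j = L₁ + M + L₂) ∧
        ∀ (A : LineBundleAInf.AInfStructure T), A.IsAdmissible τ →
          ((A.m3 s₁ e s₂).1 : W.toAffine.FunctionField) =
            ∑ j, (b j).1 * (A.m3 (p j) (q j) (r j)).1 * (c j).1) := by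
  have G := LineBundleAInf.genusOne W
  refine ⟨fun A hA n' n'' _ _ L₁' L₁'' M L₂' L₂'' d₁' d₁'' d₂' d₂'' d hT =>
    G.m3_mul_mul hA d₁' d₁'' d₂' d₂'' d hT, fun A A' hA ⟨f⟩ n _ L₁ M L₂ d₁ d d₂ hT =>
    G.m3_eq_of_homotopy hA f d₁ d d₂ hT, fun n hn L₁ M L₂ d₁ d d₂ hT s₁ e s₂ => ?_⟩
  -- The induction is indexed by the degree minus one.
  obtain ⟨n, rfl⟩ := Nat.exists_eq_add_of_le' hn
  obtain ⟨N, B, P, Q, R, C, b, p, q, r, c, h, h'⟩ :=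
    LineBundleAInf.exists_sum_of_mem_unitTripleSums (G.m3_mem_unitTripleSums (T := T) (τ := τ) n
      L₁ M L₂ (by exact_mod_cast d₁) (by exact_mod_cast d) (by exact_mod_cast d₂) hT s₁ e s₂)
  exact ⟨N, B, P, Q, R, C, b, p, q, r, c, h, fun A hA => h' ⟨A, hA⟩⟩
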